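/- Let $m,n\ge 1$ be integers. For $i\in\{1,\dots,m+n-1\}$ put $\beta_i=\frac{m}{i}$ if $i\le m$ and $\beta_i=\frac{n}{m+n-i}$ if $i>m$. Then there exists a constant $c>0$, depending only on $m$ and $n$, such that the following holds. Let $\mathbf K$ be a global function field (a finite extension of $\mathbb F_q(X)$ for a finite field $\mathbb F_q$), let $\nu$ be a normalized discrete valuation on $\mathbf K$, and let $\pi_\nu\in\mathbf K$ satisfy $\nu(\pi_\nu)=1$. Let $\mathbf K_\nu$ be the completion of $\mathbf K$ with respect to $\nu$, $\mathcal O_\nu$ its valuation ring, $q_\nu$ the cardinality of its residue field, $|x|=q_\nu^{-\nu(x)}$ its absolute value, and $\mu_{mn}$ the Haar measure on $M_{m,n}(\mathbf K_\nu)\cong \mathbf K_\nu^{mn}$ with $\mu_{mn}(M_{m,n}(\mathcal O_\nu))=1$. For $t\in\mathbb Z$ and $\mathbf s\in M_{m,n}(\mathbf K_\nu)$ let $$g_t=\begin{pmatrix}\pi_\nu^{-nt}I_m&0\\0&\pi_\nu^{mt}I_n\end{pmatrix},\qquad u_{\mathbf s}=\begin{pmatrix}I_m&\mathbf s\\0&I_n\end{pmatrix}.$$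 Matrices act on $\bigwedge^i\mathbf K_\nu^{m+n}$ by $g(\mathbf w_1\wedge\dots\wedge\mathbf w_i)=(g\mathbf w_1)\wedge\dots\wedge(g\mathbf w_i)$, and $\bigwedge^i\mathbf K_\nu^{m+n}$ carries the sup norm $\|\sum_I v_I\mathbf e_I\|=\max_I|v_I|$ with respect to its standard basis $(\mathbf e_I)$. Then for every $i\in\{1,\dots,m+n-1\}$, every integer $t\ge 1$ and every decomposable $\mathbf v\in\bigwedge^i\mathbf K_\nu^{m+n}$ (that is, $\mathbf v=\mathbf w_1\wedge\dots\wedge\mathbf w_i$ with $\mathbf w_1,\dots,\mathbf w_i\in\mathbf K_\nu^{m+n}$), $$\int_{M_{m,n}(\mathcal O_\nu)}\|g_tu_{\mathbf s}\mathbf v\|^{-\beta_i}\,d\mu_{mn}(\mathbf s)\;\le\; c\,t\,q_\nu^{-mnt}\,\|\mathbf v\|^{-\beta_i},$$ where both sides are read in $[0,\infty]$, with $0^{-\beta_i}=\infty$. -/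

import Mathlib

open scoped NNReal ENNReal WithZero RatFunc

noncomputable section

namespace LocalWedge

/-! Notions attached to a field `L` with a valuation `Valued.v : L → ℤᵐ⁰`, written
multiplicatively: `Valued.v x = WithZero.exp (-ord x)` for `x ≠ 0`. -/

section Local

variable (L : Type*) [Field L] [Valued L ℤᵐ⁰]

/-- The cardinality `q` of the residue field of the valuation ring of `L`. -/
def residueCard : ℕ :=
  Nat.card (Valued.ResidueField L)

variable {L}

open Classical in
/-- The normalized absolute value `|x| = q ^ (-ord x)` for `x ≠ 0`, and `|0| = 0`. -/
def absVal (x : L) : ℝ≥0 :=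
  if x = 0 then 0 else (residueCard L : ℝ≥0) ^ (WithZero.log (Valued.v x) : ℤ)

/-- The sup norm on the `i`-th exterior power of `L ^ d`, with respect to the standard basis
`e_I = e_{j_1} ∧ ⋯ ∧ e_{j_i}`, where `I = {j_1 < ⋯ < j_i}` runs over the `i`-element subsets of
the index set of the standard basis of `L ^ d`. -/
def wedgeNorm {d i : ℕ} (v : ⋀[L]^i (Fin d → L)) : ℝ≥0 :=
  Finset.univ.sup fun I : Set.powersetCard (Fin d) i =>
    absVal (((Pi.basisFun L (Fin d)).exteriorPower i).repr v I)

variable (L) in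
/-- The `m × n` matrices all of whose entries lie in the valuation ring of `L`. -/
def integralMatrices (m n : ℕ) : Set (Matrix (Fin m) (Fin n) L) :=
  {s | ∀ a b, s a b ∈ Valued.integer L}

end Local

section Algebra

variable {L : Type*} [Field L]

/-- An element of the `i`-th exterior power of `L ^ d` is decomposable if it is of the form
`w_1 ∧ ⋯ ∧ w_i` for some vectors `w_1, …, w_i`. -/
def IsDecomposable {d i : ℕ} (v : ⋀[L]^i (Fin d → L)) : Prop :=
  ∃ w : Fin i → (Fin d → L), v = exteriorPower.ιMulti L i w

/-- The linear action of a `d × d` matrix on the `i`-th exterior power of `L ^ d`,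
`g (w_1 ∧ ⋯ ∧ w_i) = (g w_1) ∧ ⋯ ∧ (g w_i)`. -/
def wedgeAction {d i : ℕ} (g : Matrix (Fin d) (Fin d) L) :
    ⋀[L]^i (Fin d → L) →ₗ[L] ⋀[L]^i (Fin d → L) :=
  exteriorPower.map i g.mulVecLin

/-- The `(m + n) × (m + n)` matrix with the given blocks. -/
def blockMatrix {m n : ℕ} (A : Matrix (Fin m) (Fin m) L) (B : Matrix (Fin m) (Fin n) L)
    (C : Matrix (Fin n) (Fin m) L) (D : Matrix (Fin n) (Fin n) L) :
    Matrix (Fin (m + n)) (Fin (m + n)) L :=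
  Matrix.reindex finSumFinEquiv finSumFinEquiv (Matrix.fromBlocks A B C D)

/-- The diagonal matrix `g_t` with diagonal blocks `ϖ ^ (-n t) I_m` and `ϖ ^ (m t) I_n`. -/
def diagFlow (m n : ℕ) (ϖ : L) (t : ℤ) : Matrix (Fin (m + n)) (Fin (m + n)) L :=
  blockMatrix (ϖ ^ (-(n * t)) • 1) 0 0 (ϖ ^ (m * t) • 1)

/-- The unipotent matrix `u_s` with diagonal blocks `I_m`, `I_n` and upper right block `s`. -/
def unipotent {m n : ℕ} (s : Matrix (Fin m) (Fin n) L) : Matrix (Fin (m + n)) (Fin (m + n)) L :=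
  blockMatrix 1 s 0 1

end Algebra

/-- The exponent `β_i`, equal to `m / i` if `i ≤ m` and to `n / (m + n - i)` otherwise. -/
def beta (m n i : ℕ) : ℝ :=
  if i ≤ m then (m : ℝ) / i else (n : ℝ) / ((m : ℝ) + n - i)

end LocalWedge

end

namespace LocalWedge

/-! Put the vectors `w_1, …, w_i` in the columns of a matrix `A`, so that the coordinates of `v` are
the maximal minors of `A`. Dividing by the largest one (`exists_pivots`) gives `A = B * A_f` with
`B` integral, `B_f = 1` and `|det A_f| = ‖v‖`. Each coordinate of `g_t u_s v` is then, up to sign, a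
minor of `u_s B` times `det A_f` times a power of the uniformizer that depends only on how many
upper rows the minor uses.

The minors with as many upper rows as possible, namely `min m i`, are expanded most. Raised to the
power `-β_i`, their expansion factor is exactly `q ^ (-mnt)` (`beta_mul`). If these top minors are
all divisible by `ϖ ^ l` but not all by `ϖ ^ (l + 1)`, the integrand is at most `q ^ (-mnt) * q ^ (l
* β_i) * ‖v‖ ^ (-β_i)`.

The set of `s` whose top minors are all divisible by `ϖ ^ l` has measure at most `2 ^ m * q ^ (-l *
(|m - i| + 1))` (`measure_levelSet_le`). Since `β_i ≤ |m - i| + 1` (`beta_le`), every level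
contributes a bounded multiple of `q ^ (-mnt) * ‖v‖ ^ (-β_i)`. The pivot minor of `u_s B` is a unit
for every `s` (`isUnit_det_shear`), so levels beyond `t * (m + n) ^ 2` are never needed; the number
of levels produces the factor `t`.

The measure bound is a count modulo `ϖ ^ l`. A Schur complement turns the top minors that contain
the upper pivot rows into the maximal minors of a freely varying matrix (`card_topDvd_le`), and
matrices with all maximal minors divisible by `ϖ ^ l` are counted by induction on the number of rows
(`badCount_fin_le`). -/

/-- A finite chain ring of length `N` with uniformizer `ϖ` and residue cardinality `q`. -/
structure IsChainRing (R : Type*) [CommRing R] (ϖ : R) (N q : ℕ) : Prop where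
  exists_eq : ∀ x : R, ∃ h ≤ N, ∃ u : Rˣ, x = ϖ ^ h * u
  dvd_cancel : ∀ {l h : ℕ} {y : R}, h ≤ l → l ≤ N → ϖ ^ l ∣ ϖ ^ h * y → ϖ ^ (l - h) ∣ y
  card_dvd : ∀ h ≤ N, Nat.card {x : R // ϖ ^ h ∣ x} * q ^ h = Nat.card R
  two_le : 2 ≤ q

/-! ### Counting matrices over a chain ring by the divisibility of their maximal minors -/

section Minors

variable {R : Type*} [CommRing R]

/-- Gaussian elimination: the factor `p` is taken out of the first row, multiples of `y` clear
column `j` below the unit `y j`, and the determinant is expanded along that column. Listing `j`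
first avoids a sign. -/
theorem det_submatrix_cons_of_row_eq {a : ℕ} {κ : Type*} [DecidableEq κ]
    (Z : Matrix (Fin (a + 1)) κ R) (p : R) (y : κ → R) (j : κ) (u : Rˣ) (hj : y j = u)
    (hZ : ∀ c, Z 0 c = p * y c) (τ : Fin a → {c // c ≠ j}) :
    (Z.submatrix id (Fin.cons j (fun k => (τ k : κ)) : Fin (a + 1) → κ)).det =
      p * (u * ((Matrix.of fun (r : Fin a) (c : {c // c ≠ j}) =>
        Z r.succ c - Z r.succ j * ↑u⁻¹ * y c).submatrix id τ).det) := by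
  set σ : Fin (a + 1) → κ := Fin.cons j (fun k => (τ k : κ)) with hσ
  set c : Fin (a + 1) → R := Fin.cons 0 (fun r => Z r.succ j * ↑u⁻¹) with hc
  set A : Matrix (Fin (a + 1)) (Fin (a + 1)) R :=
    Matrix.of (Fin.cons (fun k => y (σ k)) (fun r k => Z r.succ (σ k))) with hA
  set B : Matrix (Fin (a + 1)) (Fin (a + 1)) R :=
    Matrix.of (Fin.cons (fun k => y (σ k)) (fun r k => Z r.succ (σ k) - c r.succ * y (σ k))) with hB
  have h1 : Z.submatrix id σ =
      Matrix.of fun i k => (Fin.cons p (fun _ => 1) : Fin (a + 1) → R) i * A i k := by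
    ext i k
    refine Fin.cases ?_ (fun r => ?_) i
    · simp [hA, hZ]
    · simp [hA]
  have h2 : A.det = B.det := by
    refine Matrix.det_eq_of_forall_row_eq_smul_add_const c 0 (by simp [hc]) ?_
    intro i k
    refine Fin.cases ?_ (fun r => ?_) i
    · simp [hA, hB, hc]
    · simp [hA, hB]
  have h3 : B.det = u * ((Matrix.of fun (r : Fin a) (c : {c // c ≠ j}) =>
        Z r.succ c - Z r.succ j * ↑u⁻¹ * y c).submatrix id τ).det := by
    rw [Matrix.det_succ_column_zero, Fin.sum_univ_succ, Finset.sum_eq_zero]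
    · have : B.submatrix (Fin.succAbove 0) Fin.succ = (Matrix.of fun (r : Fin a)
          (c : {c // c ≠ j}) => Z r.succ c - Z r.succ j * ↑u⁻¹ * y c).submatrix id τ := by
        ext r k
        simp [hB, hσ, hc]
      rw [this]
      simp [hB, hσ, hj]
    · intro r _
      have : B r.succ 0 = 0 := by
        simp [hB, hσ, hc, hj]
      simp [this]
  rw [h1, Matrix.det_mul_column, h2, h3]
  simp [Fin.prod_univ_succ]

namespace IsChainRing

variable {ϖ : R} {N q : ℕ}

theorem card_forall_dvd (H : IsChainRing R ϖ N q) {κ : Type*} [Fintype κ] [DecidableEq κ] {h : ℕ}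
    (hh : h ≤ N) :
    Nat.card {x : κ → R // ∀ c, ϖ ^ h ∣ x c} * q ^ (h * Fintype.card κ) =
      Nat.card R ^ Fintype.card κ := by
  have : Nat.card {x : κ → R // ∀ c, ϖ ^ h ∣ x c} =
      Nat.card {x : R // ϖ ^ h ∣ x} ^ Fintype.card κ := by
    rw [← Nat.card_eq_fintype_card (α := κ), ← Nat.card_fun]
    exact Nat.card_congr (Equiv.subtypePiEquivPi (p := fun _ x => ϖ ^ h ∣ x))
  rw [this, pow_mul, ← mul_pow, H.card_dvd h hh]

theorem exists_primitive (H : IsChainRing R ϖ N q) {κ : Type*} [Finite κ] {l : ℕ} (x : κ → R)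
    (hx : ¬ ∀ c, ϖ ^ l ∣ x c) :
    ∃ h < l, ∃ (y : κ → R) (j : κ) (u : Rˣ), y j = u ∧ ∀ c, x c = ϖ ^ h * y c := by
  choose f hf u hu using fun c => H.exists_eq (x c)
  push Not at hx
  obtain ⟨c₀, hc₀⟩ := hx
  have : Nonempty κ := ⟨c₀⟩
  obtain ⟨j, hj⟩ := Finite.exists_min f
  refine ⟨f j, ?_, fun c => ϖ ^ (f c - f j) * u c, j, u j, by simp, fun c => ?_⟩
  · by_contra hlt
    apply hc₀
    rw [hu c₀]
    exact Dvd.dvd.mul_right (pow_dvd_pow _ ((not_lt.1 hlt).trans (hj c₀))) _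
  · rw [hu c, ← mul_assoc, ← pow_add, Nat.add_sub_cancel' (hj c)]

variable [Fintype R]

open Classical in
/-- The number of matrices all of whose maximal minors are divisible by `ϖ ^ l`. -/
noncomputable def badCount (ϖ : R) (α κ : Type*) [Fintype α] [DecidableEq α] [Fintype κ] (l : ℕ) : ℕ :=
  (Finset.univ.filter fun Z : Matrix α κ R => ∀ τ : α → κ, ϖ ^ l ∣ (Z.submatrix id τ).det).card

-- Once the first row is fixed, `Z` can be recovered from the rest of column `j` and from its
-- eliminated matrix. The latter has one row and one column fewer, and its minors need only be
-- divisible by `ϖ ^ (l - h)`, since the first row already supplies `ϖ ^ h`.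
open Classical in
theorem card_fiber_le (H : IsChainRing R ϖ N q) {a : ℕ} {κ : Type*} [Fintype κ] [DecidableEq κ]
    {l h : ℕ} (hl : l ≤ N) (hh : h ≤ l) (x y : κ → R) (j : κ) (u : Rˣ) (hj : y j = u)
    (hx : ∀ c, x c = ϖ ^ h * y c) :
    (Finset.univ.filter fun Z : Matrix (Fin (a + 1)) κ R =>
      (∀ τ : Fin (a + 1) → κ, ϖ ^ l ∣ (Z.submatrix id τ).det) ∧ Z 0 = x).card ≤
    Fintype.card R ^ a * badCount ϖ (Fin a) {c // c ≠ j} (l - h) := by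
  classical
  have : Fintype.card R ^ a = (Finset.univ : Finset (Fin a → R)).card := by simp
  rw [this, badCount, ← Finset.card_product]
  refine Finset.card_le_card_of_injOn (fun Z => (fun r => Z r.succ j,
    Matrix.of fun (r : Fin a) (c : {c // c ≠ j}) =>
        Z r.succ c - Z r.succ j * ↑u⁻¹ * y c)) ?_ ?_
  · intro Z hZ
    simp only [Finset.coe_filter, Finset.mem_univ, true_and, Set.mem_ofPred_eq] at hZ
    simp only [Finset.coe_product, Set.mem_prod, Finset.coe_univ, Set.mem_univ, true_and,
      Finset.coe_filter, Finset.mem_univ, Set.mem_ofPred_eq]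
    intro τ
    have h1 := hZ.1 (Fin.cons j (fun k => (τ k : κ)))
    rw [det_submatrix_cons_of_row_eq Z (ϖ ^ h) y j u hj (fun c => by rw [hZ.2, hx])] at h1
    have h2 := H.dvd_cancel hh hl h1
    exact (Units.isUnit u).dvd_mul_left.1 h2
  · intro Z hZ Z' hZ' hE
    simp only [Finset.coe_filter, Finset.mem_univ, true_and, Set.mem_ofPred_eq] at hZ hZ'
    obtain ⟨h1, h2⟩ := Prod.mk.inj hE
    ext r c
    refine Fin.cases ?_ (fun r => ?_) r
    · rw [hZ.2, hZ'.2]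
    · have h1 := congrFun h1 r
      by_cases hc : c = j
      · rw [hc]; exact h1
      · have h2 := congrFun (congrFun h2 r) ⟨c, hc⟩
        simp only [Matrix.of_apply] at h1 h2
        rw [h1] at h2
        exact sub_left_injective h2

/-- Induction on the number of rows, sorting matrices by the content `ϖ ^ h` of the first row. Rows
of content at least `h` have density `q ^ (-h * |κ|)`, which more than pays for the weaker condition
left on the remaining rows. The sum over `h` is geometric and costs a factor 2 per step. -/
theorem badCount_fin_le (H : IsChainRing R ϖ N q) (a : ℕ) :
    ∀ {κ : Type*} [Fintype κ] [DecidableEq κ] {l : ℕ}, l ≤ N → a + 1 ≤ Fintype.card κ →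
    (badCount ϖ (Fin (a + 1)) κ l : ℝ) * (q : ℝ) ^ (l * (Fintype.card κ - a)) ≤
      2 ^ a * (Fintype.card R : ℝ) ^ ((a + 1) * Fintype.card κ) := by
  classical
  have hq : (2 : ℝ) ≤ q := by exact_mod_cast H.two_le
  have hR : (0 : ℝ) < Fintype.card R := by exact_mod_cast Fintype.card_pos
  induction a with
  | zero =>
    intro κ _ _ l hl hκ
    have h1 : badCount ϖ (Fin 1) κ l ≤ Nat.card {x : κ → R // ∀ c, ϖ ^ l ∣ x c} := by
      rw [badCount, Nat.card_eq_fintype_card, Fintype.card_subtype]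
      refine Finset.card_le_card_of_injOn (fun Z => Z 0) ?_ ?_
      · intro Z hZ
        simp only [Finset.coe_filter, Finset.mem_univ, true_and, Set.mem_ofPred_eq] at hZ ⊢
        intro c
        simpa using hZ (fun _ => c)
      · intro Z _ Z' _ hE
        ext r c
        rw [Subsingleton.elim r 0]
        exact congrFun hE c
    have h2 := H.card_forall_dvd (κ := κ) hl
    have h3 := Nat.mul_le_mul_right (q ^ (l * Fintype.card κ)) h1
    rw [h2, Nat.card_eq_fintype_card] at h3
    simpa using (show ((_ : ℕ) : ℝ) ≤ ((_ : ℕ) : ℝ) from Nat.cast_le.2 h3)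
  | succ a ih =>
    intro κ _ _ l hl hκ
    set b := Fintype.card κ with hb
    set S := (Finset.univ.filter fun Z : Matrix (Fin (a + 2)) κ R =>
      ∀ τ : Fin (a + 2) → κ, ϖ ^ l ∣ (Z.submatrix id τ).det) with hS
    set D := b - (a + 1) with hD
    set r : ℝ := (Fintype.card R : ℝ) with hr
    set V : ℕ → Finset (κ → R) := fun h => Finset.univ.filter fun x => ∀ c, ϖ ^ h ∣ x c with hV
    have hVcard : ∀ h ≤ N, ((V h).card : ℝ) * q ^ (h * b) = r ^ b := by
      intro h hh
      have := H.card_forall_dvd (κ := κ) hh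
      rw [Nat.card_eq_fintype_card, Nat.card_eq_fintype_card, Fintype.card_subtype] at this
      simp only [hV, hr, hb]
      exact_mod_cast this
    -- The content of the first row, capped at `l`: at `h = l` the divisibility is automatic and the
    -- trivial count suffices.
    have hfib : ∀ x : κ → R, ∃ h ≤ l, x ∈ V h ∧
        ((S.filter fun Z => Z 0 = x).card : ℝ) * q ^ ((l - h) * D) ≤ 2 ^ a * r ^ ((a + 1) * b) := by
      intro x
      by_cases hx : ∀ c, ϖ ^ l ∣ x c
      · refine ⟨l, le_rfl, by simpa [hV] using hx, ?_⟩
        have h1 : (S.filter fun Z => Z 0 = x).card ≤ Fintype.card R ^ ((a + 1) * b) := by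
          have : Fintype.card R ^ ((a + 1) * b) =
              (Finset.univ : Finset (Matrix (Fin (a + 1)) κ R)).card := by
            rw [Finset.card_univ]
            have h0 : Fintype.card (Fin (a + 1) → κ → R) = Fintype.card R ^ ((a + 1) * b) := by
              simp [hb, pow_mul']
            exact h0.symm
          rw [this]
          refine Finset.card_le_card_of_injOn (fun Z r => Z r.succ)
            (fun _ _ => Finset.mem_coe.2 (Finset.mem_univ _)) ?_
          intro Z hZ Z' hZ' hE
          simp only [Finset.coe_filter, Set.mem_ofPred_eq] at hZ hZ'
          ext r c
          refine Fin.cases ?_ (fun r => ?_) r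
          · rw [hZ.2, hZ'.2]
          · exact congrFun (congrFun hE r) c
        have h2 : ((S.filter fun Z => Z 0 = x).card : ℝ) ≤ r ^ ((a + 1) * b) := by
          rw [hr]; exact_mod_cast h1
        have h3 : (1 : ℝ) ≤ 2 ^ a := one_le_pow₀ (by norm_num)
        have h4 : (0 : ℝ) ≤ r ^ ((a + 1) * b) := by positivity
        simp only [Nat.sub_self, zero_mul, pow_zero, mul_one]
        nlinarith
      · obtain ⟨h, hh, y, j, u, hj, hxy⟩ := H.exists_primitive x hx
        refine ⟨h, hh.le, by simp [hV, hxy], ?_⟩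
        have h1 := H.card_fiber_le (a := a + 1) hl hh.le x y j u hj hxy
        have hsub : Fintype.card {c // c ≠ j} = b - 1 := by
          rw [Fintype.card_subtype_compl, Fintype.card_subtype_eq]
        have h2 := ih (κ := {c // c ≠ j}) (l := l - h) ((Nat.sub_le _ _).trans hl) (by omega)
        rw [hsub, show b - 1 - a = D by omega] at h2
        have h3 : ((S.filter fun Z => Z 0 = x).card : ℝ) ≤
            r ^ (a + 1) * badCount ϖ (Fin (a + 1)) {c // c ≠ j} (l - h) := by
          rw [hS, Finset.filter_filter, hr]
          exact_mod_cast h1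
        calc _ ≤ r ^ (a + 1) * badCount ϖ (Fin (a + 1)) {c // c ≠ j} (l - h)
              * q ^ ((l - h) * D) := by gcongr
          _ ≤ r ^ (a + 1) * (2 ^ a * r ^ ((a + 1) * (b - 1))) := by
              rw [mul_assoc]; gcongr
          _ = 2 ^ a * r ^ ((a + 1) * b) := by
              obtain ⟨b', hb'⟩ : ∃ b', b = b' + 1 := ⟨b - 1, by omega⟩
              rw [hb']; simp only [Nat.add_sub_cancel]; ring
    choose f hfl hfV hf using hfib
    have hterm : ∀ h ∈ Finset.range (l + 1),
        (∑ x ∈ V h, if f x = h then ((S.filter fun Z => Z 0 = x).card : ℝ) * q ^ (l * D) else 0) ≤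
        2 ^ a * r ^ ((a + 1 + 1) * b) * (1 / 2) ^ h := by
      intro h hh
      have hhl : h ≤ l := Nat.lt_succ_iff.1 (Finset.mem_range.1 hh)
      have h1 : ∀ x ∈ V h,
          (if f x = h then ((S.filter fun Z => Z 0 = x).card : ℝ) * q ^ (l * D) else 0) ≤
            2 ^ a * r ^ ((a + 1) * b) * q ^ (h * D) := by
        intro x _
        split_ifs with hfx
        · have := hf x
          rw [hfx] at this
          calc _ = ((S.filter fun Z => Z 0 = x).card : ℝ) * q ^ ((l - h) * D) * q ^ (h * D) := by
                rw [mul_assoc, ← pow_add, ← add_mul, Nat.sub_add_cancel hhl]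
            _ ≤ _ := by gcongr
        · positivity
      refine (Finset.sum_le_sum h1).trans ?_
      rw [Finset.sum_const, nsmul_eq_mul]
      have h2 := hVcard h (hhl.trans hl)
      -- Since `b = D + (a + 1)`, the density of `V h` beats the loss `q ^ (h * D)` by `q ^ (h * (a
      -- + 1)) ≥ 2 ^ h`.
      have h3 : ((V h).card : ℝ) * q ^ (h * D) ≤ r ^ b * (1 / 2) ^ h := by
        have h4 : ((V h).card : ℝ) * q ^ (h * D) * 2 ^ h ≤ r ^ b := by
          rw [← h2, show h * b = h * D + h * (a + 1) by rw [← mul_add]; congr 1; omega, pow_add,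
            ← mul_assoc]
          gcongr
          rw [pow_mul']
          calc (2 : ℝ) ^ h ≤ q ^ h := by gcongr
            _ ≤ (q ^ h) ^ (a + 1) :=
              le_self_pow₀ (one_le_pow₀ (by linarith)) (by omega)
            _ = _ := by rw [← pow_mul, ← pow_mul, mul_comm]
        rw [one_div, inv_pow, ← div_eq_mul_inv, le_div_iff₀ (by positivity)]
        exact h4
      calc _ = 2 ^ a * r ^ ((a + 1) * b) * (((V h).card : ℝ) * q ^ (h * D)) := by ring
        _ ≤ 2 ^ a * r ^ ((a + 1) * b) * (r ^ b * (1 / 2) ^ h) := by gcongr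
        _ = _ := by ring
    have hcount : (S.card : ℝ) = ∑ x : κ → R, ((S.filter fun Z => Z 0 = x).card : ℝ) := by
      exact_mod_cast Finset.card_eq_sum_card_fiberwise (f := fun Z : Matrix (Fin (a + 2)) κ R => Z 0)
        (t := Finset.univ) (by simp)
    have hgeom : ∑ h ∈ Finset.range (l + 1), ((1 : ℝ) / 2) ^ h ≤ 2 := by
      have := geom_sum_eq (x := (1 / 2 : ℝ)) (by norm_num) (l + 1)
      rw [this]
      have : (0 : ℝ) < (1 / 2) ^ (l + 1) := by positivity
      rw [div_le_iff_of_neg (by norm_num)]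
      linarith
    calc (badCount ϖ (Fin (a + 2)) κ l : ℝ) * (q : ℝ) ^ (l * D)
        = ∑ x : κ → R, ((S.filter fun Z => Z 0 = x).card : ℝ) * q ^ (l * D) := by
          rw [← Finset.sum_mul, ← hcount, badCount, hS]
          congr!
      _ = ∑ x : κ → R, ∑ h ∈ Finset.range (l + 1), if x ∈ V h then
            (if f x = h then ((S.filter fun Z => Z 0 = x).card : ℝ) * q ^ (l * D) else 0)
            else 0 := by
          refine Finset.sum_congr rfl fun x _ => ?_
          rw [Finset.sum_eq_single (f x)]
          · rw [if_pos (hfV x), if_pos rfl]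
          · intro h _ hne
            rw [if_neg hne.symm, ite_self]
          · intro hn
            exact absurd (Finset.mem_range.2 (Nat.lt_succ_iff.2 (hfl x))) hn
      _ = ∑ h ∈ Finset.range (l + 1), ∑ x ∈ V h,
            if f x = h then ((S.filter fun Z => Z 0 = x).card : ℝ) * q ^ (l * D) else 0 := by
          rw [Finset.sum_comm]
          refine Finset.sum_congr rfl fun h _ => ?_
          rw [← Finset.sum_filter]
          congr 1
          ext x; simp
      _ ≤ ∑ h ∈ Finset.range (l + 1), 2 ^ a * r ^ ((a + 1 + 1) * b) * (1 / 2) ^ h :=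
          Finset.sum_le_sum hterm
      _ = 2 ^ a * r ^ ((a + 1 + 1) * b) * ∑ h ∈ Finset.range (l + 1), (1 / 2) ^ h := by
          rw [Finset.mul_sum]
      _ ≤ 2 ^ a * r ^ ((a + 1 + 1) * b) * 2 := by gcongr
      _ = 2 ^ (a + 1) * r ^ ((a + 1 + 1) * b) := by ring

theorem not_dvd_one (H : IsChainRing R ϖ N q) {l : ℕ} (hl : l ≤ N) (h0 : l ≠ 0) :
    ¬ ϖ ^ l ∣ 1 := by
  intro h
  have h1 := H.card_dvd l hl
  have h2 : Nat.card {x : R // ϖ ^ l ∣ x} = Nat.card R :=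
    Nat.card_congr (Equiv.subtypeUnivEquiv fun x => h.trans (one_dvd x))
  rw [h2] at h1
  have h3 : 0 < Nat.card R := Nat.card_pos
  have h4 : 1 < q ^ l := Nat.one_lt_pow h0 H.two_le
  nlinarith

theorem badCount_le (H : IsChainRing R ϖ N q) {α κ : Type*} [Fintype α] [DecidableEq α]
    [Fintype κ] {l : ℕ} (hl : l ≤ N) (hκ : Fintype.card α ≤ Fintype.card κ) :
    (badCount ϖ α κ l : ℝ) * (q : ℝ) ^ (l * (Fintype.card κ + 1 - Fintype.card α)) ≤
      2 ^ Fintype.card α * (Fintype.card R : ℝ) ^ (Fintype.card α * Fintype.card κ) := by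
  classical
  -- With no rows, the only minor is the empty determinant 1, so the count vanishes unless `l = 0`.
  rcases Nat.eq_zero_or_pos (Fintype.card α) with h0 | hpos
  · have : IsEmpty α := Fintype.card_eq_zero_iff.1 h0
    rcases eq_or_ne l 0 with rfl | hl0
    · have : badCount ϖ α κ 0 ≤ 1 := by
        rw [badCount]
        refine (Finset.card_filter_le _ _).trans ?_
        rw [Finset.card_univ]
        exact (Fintype.card_eq_one_iff.2
          ⟨(fun a => isEmptyElim a), fun f => funext fun a => isEmptyElim a⟩ :
            Fintype.card (α → κ → R) = 1).le
      simpa [h0] using this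
    · have : badCount ϖ α κ l = 0 := by
        rw [badCount, Finset.card_eq_zero, Finset.filter_eq_empty_iff]
        intro Z _ h
        have := h (fun a => isEmptyElim a)
        rw [Matrix.det_isEmpty] at this
        exact H.not_dvd_one hl hl0 this
      rw [this]
      simp
  · obtain ⟨a, ha⟩ : ∃ a, Fintype.card α = a + 1 := ⟨_, (Nat.succ_pred_eq_of_pos hpos).symm⟩
    have e : α ≃ Fin (a + 1) := Fintype.equivFinOfCardEq ha
    have h1 := H.badCount_fin_le a (κ := κ) hl (by omega)
    have h2 : badCount ϖ α κ l ≤ badCount ϖ (Fin (a + 1)) κ l := by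
      rw [badCount, badCount]
      refine Finset.card_le_card_of_injOn (fun Z => Z.submatrix e.symm id) ?_ ?_
      · intro Z hZ
        simp only [Finset.coe_filter, Finset.mem_univ, true_and, Set.mem_ofPred_eq] at hZ ⊢
        intro τ
        have := hZ (τ ∘ e)
        rw [← Matrix.det_submatrix_equiv_self e.symm] at this
        convert this using 2
        ext i k
        simp
      · intro Z _ Z' _ hE
        ext i k
        have := congrFun (congrFun hE (e i)) k
        simpa using this
    rw [ha, show Fintype.card κ + 1 - (a + 1) = Fintype.card κ - a by omega]
    refine le_trans ?_ (h1.trans ?_)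
    · gcongr
    · gcongr
      · norm_num
      · omega

end IsChainRing

end Minors

end LocalWedge

/-! ### Normal forms and the Schur complement of the pivot block -/

namespace LocalWedge

set_option linter.unusedSectionVars false

theorem isUnit_det_of_dvd_sub_one {A ι : Type*} [CommRing A] [Fintype ι] [DecidableEq ι] {ϖ : A}
    (hu : ∀ x, IsUnit (1 + ϖ * x)) {Y : Matrix ι ι A}
    (hY : ∀ i j, ϖ ∣ Y i j - (1 : Matrix ι ι A) i j) : IsUnit Y.det := by
  have h : (Ideal.Quotient.mk (Ideal.span {ϖ})) Y.det = Ideal.Quotient.mk (Ideal.span {ϖ}) 1 := by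
    rw [RingHom.map_det, map_one, ← Matrix.det_one (n := ι)]
    congr 1
    ext i j
    have := Ideal.Quotient.eq.2 (Ideal.mem_span_singleton.2 (hY i j))
    rw [RingHom.mapMatrix_apply, Matrix.map_apply, this, Matrix.one_apply, Matrix.one_apply]
    split_ifs <;> simp
  obtain ⟨x, hx⟩ := Ideal.mem_span_singleton.1 (Ideal.Quotient.eq.1 h)
  rw [show Y.det = 1 + ϖ * x by rw [← hx]; ring]
  exact hu x

section Reduction

variable {R α γ κ₁ κ₂ : Type*} [CommRing R] [Fintype α] [Fintype γ] [DecidableEq α] [DecidableEq γ]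
  [Fintype κ₁] [Fintype κ₂] [DecidableEq κ₁] [DecidableEq κ₂]

/-- The matrix `u_s B`, where `B` has upper block `B₁` and lower block `B₂`. -/
def shear (B₁ : Matrix α (κ₁ ⊕ κ₂) R) (B₂ : Matrix γ (κ₁ ⊕ κ₂) R) (s : Matrix α γ R) :
    Matrix (α ⊕ γ) (κ₁ ⊕ κ₂) R :=
  Matrix.fromRows (B₁ + s * B₂) B₂

/-- A choice of rows with as many upper rows as possible. -/
def IsTop {κ : Type*} [Fintype κ] (g : κ → α ⊕ γ) : Prop :=
  (Finset.univ.filter fun k => (g k).isLeft = true).card = min (Fintype.card α) (Fintype.card κ)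

/-- All minors of `u_s B` with as many upper rows as possible are divisible by `p`. -/
def TopDvd (p : R) (B₁ : Matrix α (κ₁ ⊕ κ₂) R) (B₂ : Matrix γ (κ₁ ⊕ κ₂) R) (s : Matrix α γ R) :
    Prop :=
  ∀ g : κ₁ ⊕ κ₂ → α ⊕ γ, IsTop g → p ∣ ((shear B₁ B₂ s).submatrix g id).det

/-- The block columns `(B₁; B₂)` are in normal form with respect to the pivot rows `f₁`, `f₂`. -/
structure IsNormalForm (ϖ : R) (f₁ : κ₁ → α) (f₂ : κ₂ → γ) (B₁ : Matrix α (κ₁ ⊕ κ₂) R)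
    (B₂ : Matrix γ (κ₁ ⊕ κ₂) R) : Prop where
  inj₁ : Function.Injective f₁
  inj₂ : Function.Injective f₂
  upper : ∀ a a', B₁ (f₁ a) (Sum.inl a') = (1 : Matrix κ₁ κ₁ R) a a'
  lower_left : ∀ b a, B₂ (f₂ b) (Sum.inl a) = 0
  lower_right : ∀ b b', B₂ (f₂ b) (Sum.inr b') = (1 : Matrix κ₂ κ₂ R) b b'
  dvd : ∀ c a, ϖ ∣ B₂ c (Sum.inl a)

namespace IsNormalForm

variable {ϖ : R} {f₁ : κ₁ → α} {f₂ : κ₂ → γ} {B₁ : Matrix α (κ₁ ⊕ κ₂) R}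
  {B₂ : Matrix γ (κ₁ ⊕ κ₂) R}

theorem map (h : IsNormalForm ϖ f₁ f₂ B₁ B₂) {S : Type*} [CommRing S] (φ : R →+* S) :
    IsNormalForm (φ ϖ) f₁ f₂ (B₁.map φ) (B₂.map φ) where
  inj₁ := h.inj₁
  inj₂ := h.inj₂
  upper a a' := by rw [Matrix.map_apply, h.upper, Matrix.one_apply, Matrix.one_apply]; split_ifs <;> simp
  lower_left b a := by rw [Matrix.map_apply, h.lower_left, map_zero]
  lower_right b b' := by
    rw [Matrix.map_apply, h.lower_right, Matrix.one_apply, Matrix.one_apply]; split_ifs <;> simp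
  dvd c a := map_dvd φ (h.dvd c a)

/-- The pivot block of `u_s B` in the upper rows. -/
def pivot (f₁ : κ₁ → α) (B₁ : Matrix α (κ₁ ⊕ κ₂) R) (B₂ : Matrix γ (κ₁ ⊕ κ₂) R)
    (s : Matrix α γ R) : Matrix κ₁ κ₁ R :=
  (B₁ + s * B₂).submatrix f₁ Sum.inl

/-- The lower entries of the left columns are divisible by `ϖ`, so the shear leaves the pivot block
congruent to the identity modulo `ϖ`. -/
theorem isUnit_det_pivot (h : IsNormalForm ϖ f₁ f₂ B₁ B₂) (hu : ∀ x, IsUnit (1 + ϖ * x))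
    (s : Matrix α γ R) : IsUnit (pivot f₁ B₁ B₂ s).det := by
  refine isUnit_det_of_dvd_sub_one hu fun a a' => ?_
  rw [pivot, Matrix.submatrix_apply, Matrix.add_apply, h.upper, add_sub_cancel_left,
    Matrix.mul_apply]
  exact Finset.dvd_sum fun c _ => (h.dvd c a').mul_left _

/-- The lower pivot rows read `(0 | 1)`, so this minor reduces to the pivot block. It bounds the
norm from below uniformly in `s`. -/
theorem isUnit_det_shear (h : IsNormalForm ϖ f₁ f₂ B₁ B₂) (hu : ∀ x, IsUnit (1 + ϖ * x))
    (s : Matrix α γ R) : IsUnit ((shear B₁ B₂ s).submatrix (Sum.map f₁ f₂) id).det := by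
  have : (shear B₁ B₂ s).submatrix (Sum.map f₁ f₂) id =
      Matrix.fromBlocks (pivot f₁ B₁ B₂ s) ((B₁ + s * B₂).submatrix f₁ Sum.inr) 0 1 := by
    ext i j
    rcases i with i | i <;> rcases j with j | j <;>
      simp [shear, pivot, h.lower_left, h.lower_right]
  rw [this, Matrix.det_fromBlocks_zero₂₁, Matrix.det_one, mul_one]
  exact h.isUnit_det_pivot hu s

/-- The Schur complement of the pivot block in the upper rows of `u_s B`. -/
noncomputable def schur (f₁ : κ₁ → α) (B₁ : Matrix α (κ₁ ⊕ κ₂) R) (B₂ : Matrix γ (κ₁ ⊕ κ₂) R)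
    (s : Matrix α γ R) : Matrix {a // a ∉ Set.range f₁} κ₂ R :=
  (B₁ + s * B₂).submatrix (↑) Sum.inr -
    (B₁ + s * B₂).submatrix (↑) Sum.inl * (pivot f₁ B₁ B₂ s)⁻¹ *
      (B₁ + s * B₂).submatrix f₁ Sum.inr

theorem det_schur_rows (h : IsNormalForm ϖ f₁ f₂ B₁ B₂) (hu : ∀ x, IsUnit (1 + ϖ * x))
    (s : Matrix α γ R) (ρ : κ₂ → {a // a ∉ Set.range f₁}) :
    ((shear B₁ B₂ s).submatrix (Sum.elim (Sum.inl ∘ f₁) (fun b => Sum.inl (ρ b : α))) id).det =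
      (pivot f₁ B₁ B₂ s).det * ((schur f₁ B₁ B₂ s).submatrix ρ id).det := by
  have hdet := h.isUnit_det_pivot hu s
  let _ := (pivot f₁ B₁ B₂ s).invertibleOfIsUnitDet hdet
  have : (shear B₁ B₂ s).submatrix (Sum.elim (Sum.inl ∘ f₁) (fun b => Sum.inl (ρ b : α))) id =
      Matrix.fromBlocks (pivot f₁ B₁ B₂ s) ((B₁ + s * B₂).submatrix f₁ Sum.inr)
        ((B₁ + s * B₂).submatrix (fun b => (ρ b : α)) Sum.inl)
        ((B₁ + s * B₂).submatrix (fun b => (ρ b : α)) Sum.inr) := by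
    ext i j
    rcases i with i | i <;> rcases j with j | j <;> rfl
  rw [this, Matrix.det_fromBlocks₁₁, Matrix.invOf_eq_nonsing_inv]
  rfl

-- Counterpart of `det_schur_rows` for few upper rows: when all of them are used, the missing rows
-- are lower pivot rows. Taking those whose columns lie outside the image of `τ` leaves the minor of
-- the Schur complement on the columns `τ`.
open Classical in
theorem det_schur_cols (h : IsNormalForm ϖ f₁ f₂ B₁ B₂) (hu : ∀ x, IsUnit (1 + ϖ * x))
    (s : Matrix α γ R) (τ : {a // a ∉ Set.range f₁} → κ₂) (hτ : Function.Injective τ) :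
    ((shear B₁ B₂ s).submatrix (Sum.elim (Sum.inl ∘ f₁) (fun b =>
      if hb : b ∈ Set.range τ then Sum.inl (hb.choose : α) else Sum.inr (f₂ b))) id).det =
      (pivot f₁ B₁ B₂ s).det * ((schur f₁ B₁ B₂ s).submatrix id τ).det := by
  have hdet := h.isUnit_det_pivot hu s
  let _ := (pivot f₁ B₁ B₂ s).invertibleOfIsUnitDet hdet
  set g : κ₂ → α ⊕ γ := fun b =>
    if hb : b ∈ Set.range τ then Sum.inl (hb.choose : α) else Sum.inr (f₂ b) with hg
  have hgτ : ∀ a, g (τ a) = Sum.inl (a : α) := by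
    intro a
    have hb : τ a ∈ Set.range τ := ⟨a, rfl⟩
    simp only [hg, dif_pos hb]
    rw [hτ hb.choose_spec]
  have hgn : ∀ b, b ∉ Set.range τ → g b = Sum.inr (f₂ b) := fun b hb => by
    simp only [hg, dif_neg hb]
  have : (shear B₁ B₂ s).submatrix (Sum.elim (Sum.inl ∘ f₁) g) id =
      Matrix.fromBlocks (pivot f₁ B₁ B₂ s) ((B₁ + s * B₂).submatrix f₁ Sum.inr)
        ((shear B₁ B₂ s).submatrix g Sum.inl) ((shear B₁ B₂ s).submatrix g Sum.inr) := by
    ext i j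
    rcases i with i | i <;> rcases j with j | j <;> rfl
  rw [this, Matrix.det_fromBlocks₁₁, Matrix.invOf_eq_nonsing_inv]
  congr 1
  set W := (shear B₁ B₂ s).submatrix g Sum.inr - (shear B₁ B₂ s).submatrix g Sum.inl *
    (pivot f₁ B₁ B₂ s)⁻¹ * (B₁ + s * B₂).submatrix f₁ Sum.inr with hW
  have hW1 : ∀ a b, W (τ a) b = schur f₁ B₁ B₂ s a b := by
    intro a b
    simp only [hW, schur, Matrix.sub_apply, Matrix.mul_apply, Matrix.submatrix_apply, hgτ, shear,
      Matrix.fromRows_apply_inl]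
  have hW2 : ∀ b, b ∉ Set.range τ → ∀ b', W b b' = (1 : Matrix κ₂ κ₂ R) b b' := by
    intro b hb b'
    simp only [hW, Matrix.sub_apply, Matrix.mul_apply, Matrix.submatrix_apply, hgn b hb, shear,
      Matrix.fromRows_apply_inr, h.lower_left, h.lower_right]
    simp
  -- Ordering rows and columns with the image of `τ` first makes `W` block upper triangular with an
  -- identity block at the end.
  let e : {a // a ∉ Set.range f₁} ⊕ {b // b ∉ Set.range τ} ≃ κ₂ :=
    (Equiv.sumCongr (Equiv.ofInjective τ hτ) (Equiv.refl _)).trans (Equiv.Set.sumCompl (Set.range τ))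
  have he1 : ∀ a, e (Sum.inl a) = τ a := fun a => by
    change Equiv.Set.sumCompl (Set.range τ) (Sum.inl (Equiv.ofInjective τ hτ a)) = τ a
    rw [Equiv.Set.sumCompl_apply_inl, Equiv.ofInjective_apply]
  have he2 : ∀ b, e (Sum.inr b) = b := fun b => by
    change Equiv.Set.sumCompl (Set.range τ) (Sum.inr b) = b
    exact Equiv.Set.sumCompl_apply_inr _ b
  rw [← Matrix.det_submatrix_equiv_self e W]
  have : W.submatrix e e = Matrix.fromBlocks ((schur f₁ B₁ B₂ s).submatrix id τ)
      ((schur f₁ B₁ B₂ s).submatrix id (↑)) 0 1 := by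
    ext i j
    rcases i with i | i <;> rcases j with j | j
    · simp [he1, hW1]
    · simp [he1, he2, hW1]
    · simp only [Matrix.submatrix_apply, he1, he2, hW2 i i.2, Matrix.fromBlocks_apply₂₁,
        Matrix.zero_apply]
      exact Matrix.one_apply_ne fun hij => i.2 ⟨j, hij.symm⟩
    · simp only [Matrix.submatrix_apply, he2, hW2 i i.2, Matrix.fromBlocks_apply₂₂]
      simp [Matrix.one_apply, Subtype.ext_iff]
  rw [this, Matrix.det_fromBlocks_zero₂₁, Matrix.det_one, mul_one]

theorem isTop_rows (hc : Fintype.card κ₁ + Fintype.card κ₂ ≤ Fintype.card α) (f : κ₁ ⊕ κ₂ → α) :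
    IsTop (γ := γ) (fun k => Sum.inl (f k)) := by
  simp [IsTop, hc]

theorem card_compl_range (hf : Function.Injective f₁) [Fintype {a // a ∉ Set.range f₁}] :
    Fintype.card {a // a ∉ Set.range f₁} + Fintype.card κ₁ = Fintype.card α := by
  classical
  have h1 : Fintype.card {a // a ∈ Set.range f₁} = Fintype.card κ₁ :=
    Fintype.card_congr (Equiv.ofInjective f₁ hf).symm
  have h2 := Fintype.card_subtype_compl (fun a => a ∈ Set.range f₁)
  have h3 := Fintype.card_subtype_le (fun a => a ∈ Set.range f₁)
  rw [← h1]
  have h4 : Fintype.card {a // a ∉ Set.range f₁} =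
    Fintype.card α - Fintype.card {a // a ∈ Set.range f₁} := by convert h2
  omega

theorem isTop_elim (hf : Function.Injective f₁)
    (hc : Fintype.card α ≤ Fintype.card κ₁ + Fintype.card κ₂)
    (τ : {a // a ∉ Set.range f₁} → κ₂) (hτ : Function.Injective τ) (g : κ₂ → α ⊕ γ)
    (hg : ∀ b, (g b).isLeft = true ↔ b ∈ Set.range τ) :
    IsTop (Sum.elim (Sum.inl ∘ f₁) g) := by
  classical
  rw [IsTop, Fintype.card_sum, min_eq_left hc, ← card_compl_range hf, add_comm,
    Finset.card_filter, Fintype.sum_sum_type]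
  congr 1
  · simp
  · rw [← Fintype.card_congr (Equiv.ofInjective τ hτ).symm, Fintype.card_subtype,
      ← Finset.card_filter]
    simp only [Sum.elim_inr, hg]

/-- The left columns of `u_s B` see only the columns of `s` outside the range of `f₂`, because the
lower pivot rows vanish there. Hence the pivot blocks agree, and the Schur complement yields the
rest of the right columns. The identity block in the rows `f₂` of `B₂` then recovers the remaining
columns of `s`. -/
theorem schur_injective (h : IsNormalForm ϖ f₁ f₂ B₁ B₂) {s s' : Matrix α γ R}
    (hs : ∀ a c, c ∉ Set.range f₂ → s a c = s' a c)
    (hX : (B₁ + s * B₂).submatrix f₁ Sum.inr = (B₁ + s' * B₂).submatrix f₁ Sum.inr)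
    (hZ : schur f₁ B₁ B₂ s = schur f₁ B₁ B₂ s') : s = s' := by
  classical
  have hY : ∀ a x, (B₁ + s * B₂) a (Sum.inl x) = (B₁ + s' * B₂) a (Sum.inl x) := by
    intro a x
    rw [Matrix.add_apply, Matrix.add_apply, Matrix.mul_apply, Matrix.mul_apply]
    congr 1
    refine Finset.sum_congr rfl fun c _ => ?_
    by_cases hc : c ∈ Set.range f₂
    · obtain ⟨b, rfl⟩ := hc
      rw [h.lower_left, mul_zero, mul_zero]
    · rw [hs a c hc]
  have hP : pivot f₁ B₁ B₂ s = pivot f₁ B₁ B₂ s' := by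
    ext i j
    exact hY _ _
  have hXX : ∀ a b, (B₁ + s * B₂) a (Sum.inr b) = (B₁ + s' * B₂) a (Sum.inr b) := by
    intro a b
    by_cases ha : a ∈ Set.range f₁
    · obtain ⟨a, rfl⟩ := ha
      exact congrFun (congrFun hX a) b
    · have := congrFun (congrFun hZ ⟨a, ha⟩) b
      rw [schur, schur, hX, hP] at this
      have hY' : (B₁ + s * B₂).submatrix ((↑) : {a // a ∉ Set.range f₁} → α) Sum.inl =
          (B₁ + s' * B₂).submatrix (↑) Sum.inl := by
        ext i j
        exact hY _ _
      rw [hY', Matrix.sub_apply, Matrix.sub_apply] at this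
      exact sub_left_injective this
  ext a c
  by_cases hc : c ∈ Set.range f₂
  · obtain ⟨b, rfl⟩ := hc
    have h1 := hXX a b
    rw [Matrix.add_apply, Matrix.add_apply, add_right_inj, Matrix.mul_apply, Matrix.mul_apply,
      ← sub_eq_zero, ← Finset.sum_sub_distrib, Finset.sum_eq_single (f₂ b)] at h1
    · simpa [h.lower_right, sub_eq_zero] using h1
    · intro c _ hcb
      by_cases hc : c ∈ Set.range f₂
      · obtain ⟨b', rfl⟩ := hc
        have : b' ≠ b := fun hb => hcb (by rw [hb])
        simp [h.lower_right, Matrix.one_apply_ne this]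
      · rw [hs a c hc, sub_self]
    · simp
  · exact hs a c hc

-- By `schur_injective`, each Schur complement arises from at most `|R| ^ (m * n' + k * r)` matrices
-- `s`, so the density of the bad `s` is bounded by that of the bad `m' × r` matrices. The exponent
-- depends only on `m` and the number of columns, since `m' - r = m - (k + r)`.
open Classical in
theorem card_topDvd_le [Fintype R] {N q : ℕ} (H : IsChainRing R ϖ N q)
    (h : IsNormalForm ϖ f₁ f₂ B₁ B₂) (hu : ∀ x, IsUnit (1 + ϖ * x)) {l : ℕ} (hl : l ≤ N) :
    ((Finset.univ.filter fun s : Matrix α γ R => TopDvd (ϖ ^ l) B₁ B₂ s).card : ℝ) *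
      (q : ℝ) ^ (l * ((Fintype.card α - Fintype.card (κ₁ ⊕ κ₂)) +
        (Fintype.card (κ₁ ⊕ κ₂) - Fintype.card α) + 1)) ≤
      2 ^ Fintype.card α * (Fintype.card R : ℝ) ^ (Fintype.card α * Fintype.card γ) := by
  set m := Fintype.card α with hm
  set n := Fintype.card γ with hn
  set D := (m - Fintype.card (κ₁ ⊕ κ₂)) + (Fintype.card (κ₁ ⊕ κ₂) - m) + 1 with hD
  rw [Fintype.card_sum] at hD
  have hm' := card_compl_range h.inj₁
  have hn' := card_compl_range h.inj₂
  rw [← hm] at hm'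
  rw [← hn] at hn'
  set k := Fintype.card κ₁
  set r := Fintype.card κ₂
  set m' := Fintype.card {a // a ∉ Set.range f₁} with hm''
  set n' := Fintype.card {c // c ∉ Set.range f₂} with hn''
  -- the admissible Schur complements
  obtain ⟨T, hT, hTcard⟩ : ∃ T : Finset (Matrix {a // a ∉ Set.range f₁} κ₂ R),
      (∀ s, TopDvd (ϖ ^ l) B₁ B₂ s → schur f₁ B₁ B₂ s ∈ T) ∧
      (T.card : ℝ) * (q : ℝ) ^ (l * D) ≤ 2 ^ m * (Fintype.card R : ℝ) ^ (m' * r) := by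
    have h1R : (1 : ℝ) ≤ Fintype.card R := by exact_mod_cast Fintype.card_pos
    rcases le_total r m' with hc | hc
    · refine ⟨Finset.univ.filter fun Z => ∀ ρ : κ₂ → {a // a ∉ Set.range f₁},
        ϖ ^ l ∣ (Z.submatrix ρ id).det, ?_, ?_⟩
      · intro s hs
        simp only [Finset.mem_filter, Finset.mem_univ, true_and]
        intro ρ
        have htop := isTop_rows (γ := γ) (κ₁ := κ₁) (κ₂ := κ₂) (α := α) (by omega)
          (Sum.elim f₁ (fun b => (ρ b : α)))
        have := hs _ htop
        have hg : (fun k => Sum.inl (Sum.elim f₁ (fun b => (ρ b : α)) k) : κ₁ ⊕ κ₂ → α ⊕ γ) =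
            Sum.elim (Sum.inl ∘ f₁) (fun b => Sum.inl (ρ b : α)) := by
          ext x; rcases x with x | x <;> rfl
        rw [hg, h.det_schur_rows hu] at this
        exact (h.isUnit_det_pivot hu s).dvd_mul_left.1 this
      · have hb := H.badCount_le (α := κ₂) (κ := {a // a ∉ Set.range f₁}) hl hc
        have hle : (Finset.univ.filter fun Z : Matrix {a // a ∉ Set.range f₁} κ₂ R =>
            ∀ ρ : κ₂ → {a // a ∉ Set.range f₁}, ϖ ^ l ∣ (Z.submatrix ρ id).det).card ≤
            IsChainRing.badCount ϖ κ₂ {a // a ∉ Set.range f₁} l := by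
          rw [IsChainRing.badCount]
          refine Finset.card_le_card_of_injOn Matrix.transpose ?_
            (Matrix.transpose_injective.injOn)
          intro Z hZ
          simp only [Finset.coe_filter, Finset.mem_univ, true_and, Set.mem_ofPred_eq] at hZ ⊢
          intro τ
          have := hZ τ
          rwa [← Matrix.det_transpose, Matrix.transpose_submatrix] at this
        rw [show D = m' + 1 - r by omega]
        refine le_trans (by gcongr) (hb.trans ?_)
        rw [mul_comm m' r]
        gcongr
        · norm_num
        · omega
    · refine ⟨Finset.univ.filter fun Z => ∀ τ : {a // a ∉ Set.range f₁} → κ₂,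
        ϖ ^ l ∣ (Z.submatrix id τ).det, ?_, ?_⟩
      · intro s hs
        simp only [Finset.mem_filter, Finset.mem_univ, true_and]
        intro τ
        by_cases hτ : Function.Injective τ
        · have := hs _ (isTop_elim h.inj₁ (by omega) τ hτ (fun b =>
            if hb : b ∈ Set.range τ then Sum.inl (hb.choose : α) else Sum.inr (f₂ b))
            fun b => by by_cases hb : b ∈ Set.range τ <;> simp only [hb, dite_true, dite_false,
              Sum.isLeft_inl, Sum.isLeft_inr, Bool.false_eq_true])
          rw [h.det_schur_cols hu s τ hτ] at this
          exact (h.isUnit_det_pivot hu s).dvd_mul_left.1 this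
        · simp only [Function.Injective, not_forall] at hτ
          obtain ⟨x, y, hxy, hne⟩ := hτ
          rw [Matrix.det_zero_of_column_eq hne (by simp [hxy])]
          exact dvd_zero _
      · have hb := H.badCount_le (α := {a // a ∉ Set.range f₁}) (κ := κ₂) hl hc
        have hle : (Finset.univ.filter fun Z : Matrix {a // a ∉ Set.range f₁} κ₂ R =>
            ∀ τ : {a // a ∉ Set.range f₁} → κ₂, ϖ ^ l ∣ (Z.submatrix id τ).det).card =
            IsChainRing.badCount ϖ {a // a ∉ Set.range f₁} κ₂ l := by
          rw [IsChainRing.badCount]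
          congr!
        rw [hle, show D = r + 1 - m' by omega]
        refine hb.trans ?_
        gcongr
        · norm_num
        · omega
  have hcard : (Finset.univ.filter fun s : Matrix α γ R => TopDvd (ϖ ^ l) B₁ B₂ s).card ≤
      Fintype.card R ^ (m * n' + k * r) * T.card := by
    have h1 : Fintype.card R ^ (m * n' + k * r) =
        (Finset.univ : Finset ((α → {c // c ∉ Set.range f₂} → R) × (κ₁ → κ₂ → R))).card := by
      rw [Finset.card_univ, Fintype.card_prod, Fintype.card_fun, Fintype.card_fun,
        Fintype.card_fun, Fintype.card_fun, ← pow_mul, ← pow_mul, pow_add, mul_comm n', mul_comm r]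
    rw [h1, ← Finset.card_product]
    refine Finset.card_le_card_of_injOn (fun s => ((fun a c => s a c,
      fun a b => (B₁ + s * B₂) (f₁ a) (Sum.inr b)), schur f₁ B₁ B₂ s)) ?_ ?_
    · intro s hs
      simp only [Finset.coe_filter, Finset.mem_univ, true_and, Set.mem_ofPred_eq] at hs
      simpa using hT s hs
    · intro s _ s' _ hE
      obtain ⟨h12, h3⟩ := Prod.mk.inj hE
      obtain ⟨h1, h2⟩ := Prod.mk.inj h12
      exact h.schur_injective (fun a c hc => congrFun (congrFun h1 a) ⟨c, hc⟩) h2 h3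
  calc _ ≤ ((Fintype.card R : ℝ) ^ (m * n' + k * r) * T.card) * (q : ℝ) ^ (l * D) := by
        gcongr
        exact_mod_cast hcard
    _ = (Fintype.card R : ℝ) ^ (m * n' + k * r) * (T.card * (q : ℝ) ^ (l * D)) := by ring
    _ ≤ (Fintype.card R : ℝ) ^ (m * n' + k * r) *
        (2 ^ m * (Fintype.card R : ℝ) ^ (m' * r)) := by gcongr
    _ = 2 ^ m * (Fintype.card R : ℝ) ^ (m * n) := by
      rw [mul_left_comm, ← pow_add]
      congr 2
      rw [← hn', ← hm']
      ring

end IsNormalForm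

end Reduction

end LocalWedge

/-! ### The valuation ring and its quotients as chain rings -/

namespace LocalWedge

section Integers

variable {L : Type*} [Field L] [Valued L ℤᵐ⁰]

/-- An element of `L` of valuation `exp (-1)`, as an element of the valuation ring. -/
def uniformizer (ϖ : L) (hϖ : Valued.v ϖ = WithZero.exp (-1 : ℤ)) : Valued.integer L :=
  ⟨ϖ, by
    rw [Valuation.mem_integer_iff, hϖ, ← WithZero.exp_zero, WithZero.exp_le_exp]; norm_num⟩

variable {ϖ : L} (hϖ : Valued.v ϖ = WithZero.exp (-1 : ℤ))

include hϖ in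
theorem v_pow (k : ℕ) : Valued.v (ϖ ^ k) = WithZero.exp (-(k : ℤ)) := by
  rw [map_pow, hϖ, ← WithZero.exp_nsmul]
  simp

include hϖ in
theorem v_zpow (k : ℤ) : Valued.v (ϖ ^ k) = WithZero.exp (-k) := by
  rw [map_zpow₀, hϖ, ← WithZero.exp_zsmul]
  simp

theorem isUnit_integer_iff {x : Valued.integer L} : IsUnit x ↔ Valued.v (x : L) = 1 :=
  (Valuation.integer.integers (Valued.v (R := L))).isUnit_iff_valuation_eq_one

theorem integer_dvd_iff {x y : Valued.integer L} :
    x ∣ y ↔ Valued.v (y : L) ≤ Valued.v (x : L) :=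
  (Valuation.integer.integers (Valued.v (R := L))).dvd_iff_le

theorem uniformizer_pow_dvd_iff {k : ℕ} {x : Valued.integer L} :
    uniformizer ϖ hϖ ^ k ∣ x ↔ Valued.v (x : L) ≤ WithZero.exp (-(k : ℤ)) := by
  rw [integer_dvd_iff, ← v_pow hϖ]
  rfl

theorem uniformizer_ne_zero : uniformizer ϖ hϖ ≠ 0 := by
  intro h
  have : ϖ = 0 := congrArg Subtype.val h
  rw [this, map_zero] at hϖ
  exact WithZero.exp_ne_zero hϖ.symm

theorem exists_eq_uniformizer_pow_mul {x : Valued.integer L} (hx : x ≠ 0) :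
    ∃ (k : ℕ) (u : (Valued.integer L)ˣ), x = uniformizer ϖ hϖ ^ k * u := by
  have hx0 : Valued.v (x : L) ≠ 0 := by
    rw [Valuation.ne_zero_iff]
    exact fun h => hx (Subtype.ext h)
  have h1 : Valued.v (x : L) = WithZero.exp (WithZero.log (Valued.v (x : L))) :=
    (WithZero.exp_log hx0).symm
  have h2 : WithZero.log (Valued.v (x : L)) ≤ 0 := by
    rw [← WithZero.exp_le_exp, ← h1, WithZero.exp_zero]
    exact x.2
  obtain ⟨k, hk⟩ := Int.exists_eq_neg_ofNat h2
  rw [hk] at h1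
  obtain ⟨y, hy⟩ := (uniformizer_pow_dvd_iff hϖ (k := k) (x := x)).2 h1.le
  have hyu : IsUnit y := by
    rw [isUnit_integer_iff]
    have : (x : L) = ϖ ^ k * y := congrArg Subtype.val hy
    rw [this, map_mul, v_pow hϖ] at h1
    exact (mul_eq_left₀ WithZero.exp_ne_zero).1 h1
  obtain ⟨u, rfl⟩ := hyu
  exact ⟨k, u, hy⟩

theorem isUnit_one_add_uniformizer_mul (x : Valued.integer L) :
    IsUnit (1 + uniformizer ϖ hϖ * x) := by
  rw [isUnit_integer_iff]
  have : Valued.v (ϖ * (x : L)) < 1 := by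
    rw [map_mul, hϖ]
    calc _ ≤ WithZero.exp (-1 : ℤ) * 1 := by gcongr; exact x.2
      _ < 1 := by rw [mul_one, ← WithZero.exp_zero, WithZero.exp_lt_exp]; norm_num
  exact Valuation.map_one_add_of_lt _ this

theorem not_isUnit_uniformizer : ¬ IsUnit (uniformizer ϖ hϖ) := by
  rw [isUnit_integer_iff]
  change Valued.v ϖ ≠ 1
  rw [hϖ, ← WithZero.exp_zero]
  intro h
  have := WithZero.exp_injective h
  norm_num at this

theorem irreducible_uniformizer : Irreducible (uniformizer ϖ hϖ) := by
  refine ⟨not_isUnit_uniformizer hϖ, fun a b hab => ?_⟩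
  have ha0 : a ≠ 0 := fun h => uniformizer_ne_zero hϖ (by rw [hab, h, zero_mul])
  have hb0 : b ≠ 0 := fun h => uniformizer_ne_zero hϖ (by rw [hab, h, mul_zero])
  obtain ⟨i, u, rfl⟩ := exists_eq_uniformizer_pow_mul hϖ ha0
  obtain ⟨j, w, rfl⟩ := exists_eq_uniformizer_pow_mul hϖ hb0
  rcases i with _ | i
  · left; simp
  rcases j with _ | j
  · right; simp
  exfalso
  have h1 : uniformizer ϖ hϖ * 1 =
      uniformizer ϖ hϖ * (uniformizer ϖ hϖ * (uniformizer ϖ hϖ ^ (i + j) * u * w)) := by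
    rw [mul_one]
    refine hab.trans ?_
    ring
  exact not_isUnit_uniformizer hϖ
    (IsUnit.of_mul_eq_one _ (mul_left_cancel₀ (uniformizer_ne_zero hϖ) h1).symm)

include hϖ in
theorem isDiscreteValuationRing_integer : IsDiscreteValuationRing (Valued.integer L) :=
  IsDiscreteValuationRing.ofHasUnitMulPowIrreducibleFactorization
    ⟨uniformizer ϖ hϖ, irreducible_uniformizer hϖ, fun hx => by
      obtain ⟨k, u, rfl⟩ := exists_eq_uniformizer_pow_mul hϖ hx
      exact ⟨k, u, rfl⟩⟩

theorem maximalIdeal_eq_span :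
    IsLocalRing.maximalIdeal (Valued.integer L) = Ideal.span {uniformizer ϖ hϖ} := by
  have := isDiscreteValuationRing_integer hϖ
  exact (irreducible_uniformizer hϖ).maximalIdeal_eq

/-- The quotient of the valuation ring by the `k`-th power of the maximal ideal. -/
abbrev Quot (k : ℕ) : Type _ := Valued.integer L ⧸ Ideal.span {uniformizer ϖ hϖ ^ k}

/-- The reduction modulo the `k`-th power of the maximal ideal. -/
abbrev red (k : ℕ) : Valued.integer L →+* Quot hϖ k :=
  Ideal.Quotient.mk (Ideal.span {uniformizer ϖ hϖ ^ k})

theorem red_eq_red_iff {k : ℕ} {x y : Valued.integer L} :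
    red hϖ k x = red hϖ k y ↔ Valued.v ((x : L) - y) ≤ WithZero.exp (-(k : ℤ)) := by
  rw [Ideal.Quotient.eq, Ideal.mem_span_singleton, uniformizer_pow_dvd_iff]
  rfl

theorem card_quot (k : ℕ) : Nat.card (Quot hϖ k) = residueCard L ^ k := by
  have := isDiscreteValuationRing_integer hϖ
  have h1 := cardQuot_pow_of_prime (P := IsLocalRing.maximalIdeal (Valued.integer L))
    (IsDiscreteValuationRing.not_a_field _) (i := k)
  rw [Submodule.cardQuot_apply, Submodule.cardQuot_apply] at h1
  rw [residueCard, Quot, ← Ideal.span_singleton_pow, ← maximalIdeal_eq_span hϖ]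
  exact h1

theorem isChainRing_quot [Finite (Valued.ResidueField L)] (N : ℕ) :
    IsChainRing (Quot hϖ N) (red hϖ N (uniformizer ϖ hϖ)) N (residueCard L) where
  exists_eq x := by
    obtain ⟨x, rfl⟩ := Ideal.Quotient.mk_surjective x
    have hz : red hϖ N (uniformizer ϖ hϖ ^ N) = 0 :=
      Ideal.Quotient.eq_zero_iff_mem.2 (Ideal.mem_span_singleton_self _)
    rcases eq_or_ne x 0 with rfl | hx
    · exact ⟨N, le_rfl, 1, by rw [← map_pow, hz, map_zero, zero_mul]⟩
    · obtain ⟨k, u, rfl⟩ := exists_eq_uniformizer_pow_mul hϖ hx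
      rcases le_total k N with hk | hk
      · exact ⟨k, hk, Units.map (red hϖ N).toMonoidHom u, by simp⟩
      · refine ⟨N, le_rfl, 1, ?_⟩
        rw [← map_pow, hz, zero_mul, Ideal.Quotient.eq_zero_iff_mem, Ideal.mem_span_singleton]
        exact (pow_dvd_pow _ hk).mul_right _
  dvd_cancel {l h y} hl hN hdvd := by
    obtain ⟨y, rfl⟩ := Ideal.Quotient.mk_surjective y
    obtain ⟨z, hz⟩ := hdvd
    obtain ⟨z, rfl⟩ := Ideal.Quotient.mk_surjective z
    rw [← map_pow, ← map_pow, ← map_mul, ← map_mul, Ideal.Quotient.eq, Ideal.mem_span_singleton] at hz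
    rw [← map_pow]
    refine map_dvd (red hϖ N) ?_
    have h1 : uniformizer ϖ hϖ ^ l ∣ uniformizer ϖ hϖ ^ h * y := by
      rw [← dvd_sub_left (dvd_mul_right (uniformizer ϖ hϖ ^ l) z)]
      exact (pow_dvd_pow _ hN).trans hz
    rw [← Nat.add_sub_cancel' hl, pow_add] at h1
    exact (mul_dvd_mul_iff_left (pow_ne_zero _ (uniformizer_ne_zero hϖ))).1 h1
  card_dvd h hh := by
    set I : Ideal (Quot hϖ N) := Ideal.span {red hϖ N (uniformizer ϖ hϖ) ^ h} with hI
    have h1 := Submodule.card_eq_card_quotient_mul_card I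
    have h2 : Nat.card (Quot hϖ N ⧸ I) = residueCard L ^ h := by
      rw [← card_quot hϖ]
      have hle : Ideal.span {uniformizer ϖ hϖ ^ N} ≤ Ideal.span {uniformizer ϖ hϖ ^ h} :=
        Ideal.span_singleton_le_span_singleton.2 (pow_dvd_pow _ hh)
      have hmap : I = Ideal.map (red hϖ N) (Ideal.span {uniformizer ϖ hϖ ^ h}) := by
        rw [Ideal.map_span, Set.image_singleton, map_pow]
      rw [hmap]
      exact Nat.card_congr (DoubleQuot.quotQuotEquivQuotOfLE hle).toEquiv
    rw [h1, h2]
    congr 1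
    exact Nat.card_congr (Equiv.subtypeEquivRight fun x => Ideal.mem_span_singleton.symm)
  two_le := Finite.one_lt_card (α := Valued.ResidueField L)

end Integers

/-! ### Haar measure of residue classes of integral matrices -/

section Measure

open MeasureTheory

variable {L : Type*} [Field L] [Valued L ℤᵐ⁰] {ϖ : L} (hϖ : Valued.v ϖ = WithZero.exp (-1 : ℤ))
  {m n : ℕ}

/-- The integral matrices with a given reduction modulo the `k`-th power of the maximal ideal. -/
def redFiber (k : ℕ) (T : Matrix (Fin m) (Fin n) (Quot hϖ k)) : Set (Matrix (Fin m) (Fin n) L) :=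
  {s | ∃ x : Matrix (Fin m) (Fin n) (Valued.integer L),
    x.map (red hϖ k) = T ∧ x.map (Valued.integer L).subtype = s}

include hϖ in
theorem isOpen_setOf_v_le (k : ℕ) :
    IsOpen {s : Matrix (Fin m) (Fin n) L | ∀ a b, Valued.v (s a b) ≤ WithZero.exp (-(k : ℤ))} := by
  have hO : IsOpen {x : L | Valued.v x ≤ WithZero.exp (-(k : ℤ))} := by
    have h1 : IsOpen ((fun x => (ϖ ^ k)⁻¹ * x) ⁻¹' (Valued.integer L : Set L)) :=
      (Valued.isOpen_integer L).preimage (continuous_const_mul _)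
    convert h1 using 1
    ext x
    simp only [Set.mem_ofPred_eq, Set.mem_preimage, SetLike.mem_coe, Valuation.mem_integer_iff,
      map_mul, map_inv₀, v_pow hϖ]
    rw [inv_mul_le_iff₀ WithZero.exp_pos, mul_one]
  have : {s : Matrix (Fin m) (Fin n) L | ∀ a b, Valued.v (s a b) ≤ WithZero.exp (-(k : ℤ))} =
      ⋂ a, ⋂ b, (fun s : Matrix (Fin m) (Fin n) L => s a b) ⁻¹'
        {x : L | Valued.v x ≤ WithZero.exp (-(k : ℤ))} := by
    ext s; simp
  rw [this]
  exact isOpen_iInter_of_finite fun a => isOpen_iInter_of_finite fun b =>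
    hO.preimage (continuous_id.matrix_elem a b)

theorem redFiber_eq_preimage (k : ℕ) (x : Matrix (Fin m) (Fin n) (Valued.integer L)) :
    redFiber hϖ k (x.map (red hϖ k)) =
      (fun s => -x.map (Valued.integer L).subtype + s) ⁻¹'
        {s : Matrix (Fin m) (Fin n) L | ∀ a b, Valued.v (s a b) ≤ WithZero.exp (-(k : ℤ))} := by
  ext s
  simp only [redFiber, Set.mem_ofPred_eq, Set.mem_preimage]
  constructor
  · rintro ⟨y, hy, rfl⟩ a b
    have := congrFun (congrFun hy a) b
    simp only [Matrix.map_apply] at this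
    rw [red_eq_red_iff] at this
    rw [Matrix.add_apply, Matrix.neg_apply, neg_add_eq_sub]
    exact this
  · intro h
    have h1 : ∀ a b, Valued.v (s a b - x a b) ≤ WithZero.exp (-(k : ℤ)) := fun a b => by
      have := h a b
      rwa [Matrix.add_apply, Matrix.neg_apply, neg_add_eq_sub] at this
    have hs : ∀ a b, s a b ∈ Valued.integer L := fun a b => by
      have h2 : s a b = (s a b - x a b) + x a b := by ring
      rw [h2]
      refine Subring.add_mem _ ?_ (x a b).2
      refine (h1 a b).trans ?_
      rw [← WithZero.exp_zero, WithZero.exp_le_exp]; omega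
    refine ⟨Matrix.of fun a b => ⟨s a b, hs a b⟩, ?_, ?_⟩
    · ext a b
      exact (red_eq_red_iff hϖ).2 (h1 a b)
    · ext a b; rfl

theorem exists_lift (k : ℕ) (T : Matrix (Fin m) (Fin n) (Quot hϖ k)) :
    ∃ x : Matrix (Fin m) (Fin n) (Valued.integer L), x.map (red hϖ k) = T := by
  choose f hf using fun a b => Ideal.Quotient.mk_surjective (T a b)
  exact ⟨Matrix.of f, by ext a b; exact hf a b⟩

theorem redFiber_subset (k : ℕ) (T : Matrix (Fin m) (Fin n) (Quot hϖ k)) :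
    redFiber hϖ k T ⊆ integralMatrices L m n := by
  rintro s ⟨x, _, rfl⟩ a b
  exact (x a b).2

theorem disjoint_redFiber (k : ℕ) {T T' : Matrix (Fin m) (Fin n) (Quot hϖ k)} (h : T ≠ T') :
    Disjoint (redFiber hϖ k T) (redFiber hϖ k T') := by
  rw [Set.disjoint_left]
  rintro s ⟨x, hx, hxs⟩ ⟨y, hy, hys⟩
  apply h
  rw [← hx, ← hy]
  congr 1
  ext a b
  exact congrFun (congrFun (hxs.trans hys.symm) a) b

variable [MeasurableSpace (Matrix (Fin m) (Fin n) L)] [BorelSpace (Matrix (Fin m) (Fin n) L)]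

theorem measurableSet_redFiber (k : ℕ) (T : Matrix (Fin m) (Fin n) (Quot hϖ k)) :
    MeasurableSet (redFiber hϖ k T) := by
  obtain ⟨x, rfl⟩ := exists_lift hϖ k T
  rw [redFiber_eq_preimage]
  exact (measurable_const_add _) (isOpen_setOf_v_le hϖ k).measurableSet

variable (μ : Measure (Matrix (Fin m) (Fin n) L)) [μ.IsAddHaarMeasure]

/-- Each residue class is a translate of the same open ball, and distinct classes are disjoint. -/
theorem measure_biUnion_redFiber (k : ℕ) (S : Finset (Matrix (Fin m) (Fin n) (Quot hϖ k))) :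
    μ (⋃ T ∈ S, redFiber hϖ k T) = S.card *
      μ {s : Matrix (Fin m) (Fin n) L | ∀ a b, Valued.v (s a b) ≤ WithZero.exp (-(k : ℤ))} := by
  rw [measure_biUnion_finset (fun T _ T' _ h => disjoint_redFiber hϖ k h)
    (fun T _ => measurableSet_redFiber hϖ k T), Finset.sum_congr rfl, Finset.sum_const,
    nsmul_eq_mul]
  intro T _
  obtain ⟨x, rfl⟩ := exists_lift hϖ k T
  rw [redFiber_eq_preimage, measure_preimage_add]

variable (h1 : μ (integralMatrices L m n) = 1)

-- The residue classes are disjoint, have equal positive measure and lie in a set of measure 1, so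
-- there are finitely many. Finiteness of the residue field is obtained from this with `k = 1`.
include h1 in
theorem finite_quot (hm : 1 ≤ m) (hn : 1 ≤ n) (k : ℕ) : Finite (Quot hϖ k) := by
  have hpos : 0 < μ {s : Matrix (Fin m) (Fin n) L |
      ∀ a b, Valued.v (s a b) ≤ WithZero.exp (-(k : ℤ))} :=
    (isOpen_setOf_v_le hϖ k).measure_pos μ ⟨0, fun a b => by simp⟩
  set p := μ {s : Matrix (Fin m) (Fin n) L |
      ∀ a b, Valued.v (s a b) ≤ WithZero.exp (-(k : ℤ))}
  have hle : ∀ S : Finset (Matrix (Fin m) (Fin n) (Quot hϖ k)), (S.card : ℝ≥0∞) * p ≤ 1 := by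
    intro S
    rw [← measure_biUnion_redFiber hϖ μ k S, ← h1]
    exact measure_mono (Set.iUnion₂_subset fun T _ => redFiber_subset hϖ k T)
  have hfin : Finite (Matrix (Fin m) (Fin n) (Quot hϖ k)) := by
    by_contra hinf
    rw [not_finite_iff_infinite] at hinf
    obtain ⟨N, hN⟩ := ENNReal.exists_nat_mul_gt hpos.ne' ENNReal.one_ne_top
    obtain ⟨S, hS⟩ := Infinite.exists_subset_card_eq (Matrix (Fin m) (Fin n) (Quot hϖ k)) N
    have := hle S
    rw [hS] at this
    exact absurd this (not_le.2 hN)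
  exact Finite.of_injective
    (fun r => (Matrix.of fun _ _ => r : Matrix (Fin m) (Fin n) (Quot hϖ k)))
    fun r r' h => congrFun (congrFun h ⟨0, hm⟩) ⟨0, hn⟩

include h1 in
theorem card_mul_measure [Fintype (Matrix (Fin m) (Fin n) (Quot hϖ k))] :
    (Fintype.card (Matrix (Fin m) (Fin n) (Quot hϖ k)) : ℝ≥0∞) *
      μ {s : Matrix (Fin m) (Fin n) L | ∀ a b, Valued.v (s a b) ≤ WithZero.exp (-(k : ℤ))} = 1 := by
  rw [← h1, ← Finset.card_univ, ← measure_biUnion_redFiber hϖ μ k Finset.univ]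
  congr 1
  refine subset_antisymm (Set.iUnion₂_subset fun T _ => redFiber_subset hϖ k T) fun s hs => ?_
  simp only [Finset.mem_univ, Set.iUnion_true, Set.mem_iUnion]
  exact ⟨_, Matrix.of fun a b => ⟨s a b, hs a b⟩, rfl, rfl⟩

end Measure

end LocalWedge

/-! ### Absolute values, minors and the sup norm on exterior powers -/

namespace LocalWedge

section AbsVal

variable {L : Type*} [Field L] [Valued L ℤᵐ⁰]

theorem absVal_zero : absVal (0 : L) = 0 := by simp [absVal]

theorem absVal_of_v_eq {x : L} {k : ℤ} (h : Valued.v x = WithZero.exp k) :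
    absVal x = (residueCard L : ℝ≥0) ^ k := by
  have hx : x ≠ 0 := by
    rintro rfl
    rw [map_zero] at h
    exact WithZero.exp_ne_zero h.symm
  rw [absVal, if_neg hx, h, WithZero.log_exp]

theorem absVal_mul (hq : 2 ≤ residueCard L) (x y : L) : absVal (x * y) = absVal x * absVal y := by
  have hq0 : (residueCard L : ℝ≥0) ≠ 0 := by exact_mod_cast (by omega : residueCard L ≠ 0)
  by_cases hx : x = 0
  · simp [absVal, hx]
  by_cases hy : y = 0
  · simp [absVal, hy]
  have hx' : Valued.v x ≠ 0 := (Valuation.ne_zero_iff _).2 hx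
  have hy' : Valued.v y ≠ 0 := (Valuation.ne_zero_iff _).2 hy
  rw [absVal, absVal, absVal, if_neg hx, if_neg hy, if_neg (mul_ne_zero hx hy), map_mul,
    WithZero.log_mul hx' hy', zpow_add₀ hq0]

theorem absVal_of_v_eq_one {x : L} (h : Valued.v x = 1) : absVal x = 1 := by
  rw [absVal_of_v_eq (k := 0) (by rw [h, WithZero.exp_zero]), zpow_zero]

theorem absVal_mono (hq : 2 ≤ residueCard L) {x y : L} (h : Valued.v x ≤ Valued.v y) : absVal x ≤ absVal y := by
  have hq1 : (1 : ℝ≥0) ≤ residueCard L := by exact_mod_cast (by omega : 1 ≤ residueCard L)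
  by_cases hx : x = 0
  · simp [absVal, hx]
  have hx' : Valued.v x ≠ 0 := (Valuation.ne_zero_iff _).2 hx
  have hy' : Valued.v y ≠ 0 := fun h0 => hx' (le_zero_iff.1 (h0 ▸ h))
  have hy : y ≠ 0 := (Valuation.ne_zero_iff _).1 hy'
  rw [absVal, absVal, if_neg hx, if_neg hy]
  exact zpow_le_zpow_right₀ hq1 ((WithZero.log_le_log hx' hy').2 h)

theorem le_absVal_of_lt (hq : 2 ≤ residueCard L) {x : L} {k : ℤ} (h : WithZero.exp k < Valued.v x) :
    (residueCard L : ℝ≥0) ^ (k + 1) ≤ absVal x := by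
  have hq1 : (1 : ℝ≥0) ≤ residueCard L := by exact_mod_cast (by omega : 1 ≤ residueCard L)
  have hx' : Valued.v x ≠ 0 := (WithZero.exp_pos.trans h).ne'
  rw [absVal_of_v_eq (WithZero.exp_log hx').symm]
  refine zpow_le_zpow_right₀ hq1 ?_
  rw [← WithZero.exp_log hx', WithZero.exp_lt_exp] at h
  omega

theorem absVal_neg_one_pow_mul (hq : 2 ≤ residueCard L) (k : ℤˣ) (x : L) : absVal ((k : ℤ) * x) = absVal x := by
  have : Valued.v (((k : ℤ) : L) * x) = Valued.v x := by
    rcases Int.units_eq_one_or k with rfl | rfl <;> simp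
  exact le_antisymm (absVal_mono hq this.le) (absVal_mono hq this.ge)

/-- Arbitrary row selections are allowed: reordering changes only the sign, and a repeated row gives
0. -/
theorem absVal_minor_le_wedgeNorm (hq : 2 ≤ residueCard L) {d i : ℕ} (w : Fin i → Fin d → L) (f : Fin i → Fin d) :
    absVal (Matrix.of fun a b => w b (f a)).det ≤ wedgeNorm (exteriorPower.ιMulti L i w) := by
  by_cases hf : Function.Injective f
  · have hcard : (Finset.univ.map ⟨f, hf⟩).card = i := by simp
    let I : Set.powersetCard (Fin d) i := ⟨Finset.univ.map ⟨f, hf⟩, hcard⟩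
    let o := Set.powersetCard.ofFinEmbEquiv.symm I
    have hmem : ∀ a, ∃ b, o b = f a := fun a => by
      have := (Set.powersetCard.mem_range_ofFinEmbEquiv_symm_iff_mem I (f a)).2 (by
        change f a ∈ Finset.univ.map ⟨f, hf⟩
        simp)
      exact this
    choose σ hσ using hmem
    have hσi : Function.Injective σ := fun a b hab => hf (by rw [← hσ, ← hσ, hab])
    let e : Equiv.Perm (Fin i) := Equiv.ofBijective σ (Finite.injective_iff_bijective.1 hσi)
    have h1 : (Matrix.of fun a b => w b (f a)).det =
        ((Equiv.Perm.sign e : ℤ) : L) * (Matrix.of fun a b => w b (o a)).det := by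
      rw [← Matrix.det_permute e]
      congr 1
      ext a b
      simp [e, hσ]
    rw [h1, absVal_neg_one_pow_mul hq]
    refine le_trans (le_of_eq ?_)
      (Finset.le_sup (f := fun I : Set.powersetCard (Fin d) i => absVal
        (((Pi.basisFun L (Fin d)).exteriorPower i).repr (exteriorPower.ιMulti L i w) I))
        (Finset.mem_univ I))
    rw [exteriorPower.basis_repr_apply, exteriorPower.ιMultiDual_apply_ιMulti,
      ← Matrix.det_transpose]
    rfl
  · simp only [Function.Injective, not_forall] at hf
    obtain ⟨a, b, hab, hne⟩ := hf
    rw [Matrix.det_zero_of_row_eq hne (by ext c; simp [hab]), absVal_zero]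
    exact zero_le

theorem wedgeNorm_le_of_minor_le {d i : ℕ} (w : Fin i → Fin d → L) {c : ℝ≥0}
    (hc : ∀ f : Fin i → Fin d, absVal (Matrix.of fun a b => w b (f a)).det ≤ c) :
    wedgeNorm (exteriorPower.ιMulti L i w) ≤ c := by
  refine Finset.sup_le fun I _ => ?_
  rw [exteriorPower.basis_repr_apply, exteriorPower.ιMultiDual_apply_ιMulti,
    ← Matrix.det_transpose]
  exact hc _

end AbsVal

/-! ### Normal form of a decomposable vector -/

section NormalForm

variable {L : Type*} [Field L]

theorem det_submatrix_update_of_submatrix_eq_one {ι κ : Type*} [Fintype κ] [DecidableEq κ]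
    (B : Matrix ι κ L) (f : κ → ι) (hB : B.submatrix f id = 1) (b : κ) (r : ι) :
    (B.submatrix (Function.update f b r) id).det = B r b := by
  have : B.submatrix (Function.update f b r) id = (1 : Matrix κ κ L).updateRow b (B r) := by
    ext a c
    by_cases ha : a = b
    · subst ha; simp
    · rw [Matrix.updateRow_ne ha, ← hB]
      simp [ha]
  rw [this, ← Matrix.cramer_transpose_apply, Matrix.transpose_one, Matrix.cramer_one]
  rfl

/-- The diagonal entries of `diagFlow`. -/
def flowWeight (m n : ℕ) (ϖ : L) (t : ℤ) : Fin m ⊕ Fin n → L :=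
  Sum.elim (fun _ => ϖ ^ (-(n * t))) (fun _ => ϖ ^ (m * t))

theorem flow_mulVec {m n : ℕ} (ϖ : L) (t : ℤ) (s : Matrix (Fin m) (Fin n) L)
    (x : Fin (m + n) → L) (r : Fin m ⊕ Fin n) :
    ((diagFlow m n ϖ t * unipotent s).mulVecLin x) (finSumFinEquiv r) =
      flowWeight m n ϖ t r * Sum.elim (fun a => x (finSumFinEquiv (Sum.inl a)) +
        ∑ b, s a b * x (finSumFinEquiv (Sum.inr b))) (fun b => x (finSumFinEquiv (Sum.inr b))) r := by
  have h1 : diagFlow m n ϖ t * unipotent s = Matrix.reindex finSumFinEquiv finSumFinEquiv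
      (Matrix.fromBlocks (ϖ ^ (-(n * t)) • 1) (ϖ ^ (-(n * t)) • s) 0 (ϖ ^ (m * t) • 1)) := by
    rw [diagFlow, unipotent, blockMatrix, blockMatrix, Matrix.reindex_apply, Matrix.reindex_apply,
      Matrix.reindex_apply, Matrix.submatrix_mul_equiv, Matrix.fromBlocks_multiply]
    simp
  rw [h1, Matrix.mulVecLin_apply, Matrix.mulVec, dotProduct,
    ← finSumFinEquiv.sum_comp, Fintype.sum_sum_type]
  rcases r with a | b
  · simp [flowWeight, Matrix.one_apply, mul_add, Finset.mul_sum, mul_assoc]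
  · simp [flowWeight, Matrix.one_apply]

variable [Valued L ℤᵐ⁰]

/-- A matrix of full rank is the product of a matrix with integral entries containing an identity
block and of an invertible matrix; the block can be chosen so that pivots in the lower rows are
preferred. -/
theorem exists_pivots {α γ κ : Type*} [Finite α] [Finite γ] [Fintype κ] [DecidableEq κ]
    (A : Matrix (α ⊕ γ) κ L) (hA : ∃ f : κ → α ⊕ γ, (A.submatrix f id).det ≠ 0) :
    ∃ (f : κ → α ⊕ γ) (B : Matrix (α ⊕ γ) κ L), (A.submatrix f id).det ≠ 0 ∧
      (∀ g : κ → α ⊕ γ, Valued.v (A.submatrix g id).det ≤ Valued.v (A.submatrix f id).det) ∧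
      A = B * A.submatrix f id ∧ B.submatrix f id = 1 ∧ (∀ r b, Valued.v (B r b) ≤ 1) ∧
      ∀ c b, (f b).isLeft = true → Valued.v (B (Sum.inr c) b) < 1 := by
  obtain ⟨f₀, hf₀⟩ := hA
  have : Nonempty (κ → α ⊕ γ) := ⟨f₀⟩
  -- The lexicographic order maximizes the minor first and breaks ties by the number of lower rows.
  let F : (κ → α ⊕ γ) → ℤᵐ⁰ ×ₗ ℕ := fun g =>
    toLex (Valued.v (A.submatrix g id).det,
      (Finset.univ.filter fun b => (g b).isRight = true).card)
  obtain ⟨f, hf⟩ := Finite.exists_max F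
  have hmax : ∀ g : κ → α ⊕ γ,
      Valued.v (A.submatrix g id).det ≤ Valued.v (A.submatrix f id).det := fun g => by
    rcases Prod.Lex.le_iff.1 (hf g) with h | h
    · exact h.le
    · exact h.1.le
  have hdet : (A.submatrix f id).det ≠ 0 := by
    intro h0
    have := hmax f₀
    rw [h0, map_zero, le_zero_iff, map_eq_zero] at this
    exact hf₀ this
  have hunit : IsUnit (A.submatrix f id).det := isUnit_iff_ne_zero.2 hdet
  set B := A * (A.submatrix f id)⁻¹ with hBdef
  have hAB : A = B * A.submatrix f id := by
    rw [hBdef, Matrix.mul_assoc, Matrix.nonsing_inv_mul _ hunit, Matrix.mul_one]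
  have hB1 : B.submatrix f id = 1 := by
    rw [← Matrix.mul_nonsing_inv _ hunit]
    ext a b
    rfl
  have hminor : ∀ g : κ → α ⊕ γ,
      (A.submatrix g id).det = (B.submatrix g id).det * (A.submatrix f id).det := fun g => by
    rw [← Matrix.det_mul]
    conv_lhs => rw [hAB]
    rfl
  -- Exchanging pivot row `b` for `r` multiplies the minor by `B r b`, so maximality makes `B`
  -- integral.
  have hupd : ∀ r b, Valued.v (A.submatrix (Function.update f b r) id).det =
      Valued.v (B r b) * Valued.v (A.submatrix f id).det := fun r b => by
    rw [hminor, det_submatrix_update_of_submatrix_eq_one B f hB1, map_mul]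
  have hvpos : 0 < Valued.v (A.submatrix f id).det := zero_lt_iff.2 ((Valuation.ne_zero_iff _).2 hdet)
  have hB : ∀ r b, Valued.v (B r b) ≤ 1 := fun r b => by
    have := hmax (Function.update f b r)
    rw [hupd] at this
    exact (mul_le_iff_le_one_left hvpos).1 this
  -- A unit entry here would let a lower row replace an upper pivot without shrinking the minor,
  -- against the tie-break.
  refine ⟨f, B, hdet, hmax, hAB, hB1, hB, fun c b hb => lt_of_le_of_ne (hB _ _) fun h1 => ?_⟩
  have h2 := hupd (Sum.inr c) b
  rw [h1, one_mul] at h2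
  have h3 := hf (Function.update f b (Sum.inr c))
  rcases Prod.Lex.le_iff.1 h3 with h | h
  · exact h.ne h2
  · refine absurd h.2 (not_le.2 (Finset.card_lt_card ?_))
    rw [Finset.ssubset_iff_of_subset]
    · refine ⟨b, by simp, ?_⟩
      simp only [Finset.mem_filter, Finset.mem_univ, true_and]
      rcases hfb : f b with a | a
      · simp
      · rw [hfb] at hb; simp at hb
    · intro a ha
      simp only [Finset.mem_filter, Finset.mem_univ, true_and] at ha ⊢
      by_cases hab : a = b
      · subst hab; simp
      · rwa [Function.update_of_ne hab]

/-- Since `A = B * A_f`, every minor of `g_t u_s A` factors as weight times minor of `u_s B` times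
`det A_f`, and the last factor has absolute value `‖v‖`. Any such minor bounds the sup norm from
below. -/
theorem exists_isNormalForm {m n i : ℕ} {ϖ : L} (hϖ : Valued.v ϖ = WithZero.exp (-1 : ℤ))
    (hq : 2 ≤ residueCard L) (w : Fin i → Fin (m + n) → L)
    (hw : wedgeNorm (exteriorPower.ιMulti L i w) ≠ 0) :
    ∃ (κ₁ κ₂ : Type) (_ : Fintype κ₁) (_ : Fintype κ₂) (_ : DecidableEq κ₁) (_ : DecidableEq κ₂)
      (f₁ : κ₁ → Fin m) (f₂ : κ₂ → Fin n)
      (B₁ : Matrix (Fin m) (κ₁ ⊕ κ₂) (Valued.integer L))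
      (B₂ : Matrix (Fin n) (κ₁ ⊕ κ₂) (Valued.integer L)),
      IsNormalForm (uniformizer ϖ hϖ) f₁ f₂ B₁ B₂ ∧ Fintype.card (κ₁ ⊕ κ₂) = i ∧
      ∀ (t : ℤ) (x : Matrix (Fin m) (Fin n) (Valued.integer L)) (g : κ₁ ⊕ κ₂ → Fin m ⊕ Fin n),
        wedgeNorm (exteriorPower.ιMulti L i w) * (absVal (∏ k, flowWeight m n ϖ t (g k)) *
          absVal ((((shear B₁ B₂ x).submatrix g id).det : Valued.integer L) : L)) ≤
        wedgeNorm (wedgeAction (diagFlow m n ϖ t *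
          unipotent (x.map (Valued.integer L).subtype)) (exteriorPower.ιMulti L i w)) := by
  classical
  set A : Matrix (Fin m ⊕ Fin n) (Fin i) L := Matrix.of fun r j => w j (finSumFinEquiv r) with hAdef
  have hA : ∃ f : Fin i → Fin m ⊕ Fin n, (A.submatrix f id).det ≠ 0 := by
    by_contra! h
    refine hw (le_zero_iff.1 (wedgeNorm_le_of_minor_le w fun f => ?_))
    have := h (finSumFinEquiv.symm ∘ f)
    rw [← absVal_zero (L := L), ← this]
    refine le_of_eq (congrArg (fun M : Matrix (Fin i) (Fin i) L => absVal M.det) ?_)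
    ext a b
    simp [hAdef]
  obtain ⟨f, B, hdet, hmax, hAB, hB1, hB, hBlt⟩ := exists_pivots A hA
  have hfinj : Function.Injective f := by
    intro a b hab
    by_contra hne
    exact hdet (Matrix.det_zero_of_row_eq hne (by ext c; simp [hab]))
  have hδ : wedgeNorm (exteriorPower.ιMulti L i w) = absVal (A.submatrix f id).det := by
    refine le_antisymm (wedgeNorm_le_of_minor_le w fun g => ?_) ?_
    · refine le_trans (le_of_eq ?_) (absVal_mono hq (hmax (finSumFinEquiv.symm ∘ g)))
      refine congrArg (fun M : Matrix (Fin i) (Fin i) L => absVal M.det) ?_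
      ext a b
      simp [hAdef]
    · exact absVal_minor_le_wedgeNorm hq w (finSumFinEquiv ∘ f)
  let e : {b // (f b).isLeft = true} ⊕ {b // ¬ (f b).isLeft = true} ≃ Fin i :=
    Equiv.sumCompl fun b => (f b).isLeft = true
  let f₁ : {b // (f b).isLeft = true} → Fin m := fun b => (f b).getLeft b.2
  let f₂ : {b // ¬ (f b).isLeft = true} → Fin n := fun b => (f b).getRight (by simpa using b.2)
  have hf₁ : ∀ b, Sum.inl (f₁ b) = f b := fun b => Sum.inl_getLeft _ _
  have hf₂ : ∀ b, Sum.inr (f₂ b) = f b := fun b => Sum.inr_getRight _ _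
  let B₁ : Matrix (Fin m) ({b // (f b).isLeft = true} ⊕ {b // ¬ (f b).isLeft = true})
    (Valued.integer L) := Matrix.of fun a k => ⟨B (Sum.inl a) (e k), hB _ _⟩
  let B₂ : Matrix (Fin n) ({b // (f b).isLeft = true} ⊕ {b // ¬ (f b).isLeft = true})
    (Valued.integer L) := Matrix.of fun c k => ⟨B (Sum.inr c) (e k), hB _ _⟩
  have hBf : ∀ a b, B (f a) b = (1 : Matrix (Fin i) (Fin i) L) a b := fun a b =>
    congrFun (congrFun hB1 a) b
  refine ⟨_, _, inferInstance, inferInstance, inferInstance, inferInstance, f₁, f₂, B₁, B₂,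
    ⟨?_, ?_, ?_, ?_, ?_, ?_⟩, ?_, ?_⟩
  · intro a b hab
    exact Subtype.ext (hfinj (by rw [← hf₁, ← hf₁, hab]))
  · intro a b hab
    exact Subtype.ext (hfinj (by rw [← hf₂, ← hf₂, hab]))
  · intro a b
    apply Subtype.ext
    change B (Sum.inl (f₁ a)) b = _
    rw [hf₁, hBf, Matrix.one_apply, Matrix.one_apply]
    simp only [Subtype.ext_iff]
    split_ifs <;> rfl
  · intro a b
    apply Subtype.ext
    change B (Sum.inr (f₂ a)) b = _
    rw [hf₂, hBf, Matrix.one_apply_ne]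
    · rfl
    · intro h
      exact a.2 (h ▸ b.2)
  · intro a b
    apply Subtype.ext
    change B (Sum.inr (f₂ a)) b = _
    rw [hf₂, hBf, Matrix.one_apply, Matrix.one_apply]
    simp only [Subtype.ext_iff]
    split_ifs <;> rfl
  · intro c a
    rw [← pow_one (uniformizer ϖ hϖ), uniformizer_pow_dvd_iff]
    change Valued.v (B (Sum.inr c) a) ≤ _
    have h1 := hBlt c a a.2
    by_cases h0 : Valued.v (B (Sum.inr c) a) = 0
    · rw [h0]; exact zero_le
    · rw [← WithZero.exp_log h0, ← WithZero.exp_zero, WithZero.exp_lt_exp] at h1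
      rw [← WithZero.exp_log h0, WithZero.exp_le_exp]
      push_cast
      omega
  · rw [Fintype.card_congr e, Fintype.card_fin]
  · intro t x g
    rw [hδ, wedgeAction, exteriorPower.map_apply_ιMulti, ← absVal_mul hq, ← absVal_mul hq]
    refine le_trans (le_of_eq ?_) (absVal_minor_le_wedgeNorm hq _ (finSumFinEquiv ∘ g ∘ e.symm))
    congr 1
    have hshear : ∀ r j, Sum.elim (fun a => A (Sum.inl a) j +
        ∑ b, (x a b : L) * A (Sum.inr b) j) (fun b => A (Sum.inr b) j) r =
        ((Matrix.of fun r k => ((shear B₁ B₂ x r (e.symm k) : Valued.integer L) : L)) * A.submatrix f id) r j := by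
      intro r j
      have hAr : ∀ r, A r j = ∑ k, B r k * A (f k) j := fun r => by
        conv_lhs => rw [hAB]
        rfl
      rw [Matrix.mul_apply]
      rcases r with a | b
      · simp only [Sum.elim_inl, Matrix.of_apply, shear, Matrix.fromRows_apply_inl,
          Matrix.add_apply, Matrix.mul_apply, Subring.coe_add, Matrix.submatrix_apply, id]
        rw [hAr (Sum.inl a)]
        simp only [hAr (Sum.inr _), Finset.mul_sum, add_mul, Finset.sum_add_distrib]
        congr 1
        · simp [B₁]
        · rw [Finset.sum_comm]
          refine Finset.sum_congr rfl fun k _ => ?_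
          rw [AddSubmonoidClass.coe_finsetSum, Finset.sum_mul]
          refine Finset.sum_congr rfl fun c _ => ?_
          simp [B₂, mul_assoc]
      · rw [Sum.elim_inr, hAr]
        simp [B₂, shear]
    have hM : (Matrix.of fun a b => ((fun j => (diagFlow m n ϖ t *
        unipotent (x.map (Valued.integer L).subtype)).mulVecLin (w j)) b)
          ((finSumFinEquiv ∘ g ∘ e.symm) a)) =
        Matrix.of fun a b => flowWeight m n ϖ t (g (e.symm a)) *
          (((Matrix.of fun r k => ((shear B₁ B₂ x r (e.symm k) : Valued.integer L) : L)).submatrix (g ∘ e.symm) id) *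
            A.submatrix f id) a b := by
      ext a b
      simp only [Matrix.of_apply, Function.comp_apply]
      rw [flow_mulVec]
      congr 1
      exact hshear (g (e.symm a)) b
    refine Eq.trans ?_ (congrArg Matrix.det hM).symm
    rw [Matrix.det_mul_column, Matrix.det_mul, e.symm.prod_comp fun k => flowWeight m n ϖ t (g k)]
    have hd : ((Matrix.of fun r k => ((shear B₁ B₂ x r (e.symm k) : Valued.integer L) : L)).submatrix
        (g ∘ e.symm) id).det =
        ((((shear B₁ B₂ x).submatrix g id).det : Valued.integer L) : L) := by
      rw [← Matrix.det_submatrix_equiv_self e]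
      change _ = (Valued.integer L).subtype _
      rw [RingHom.map_det]
      congr 1
      ext a b
      simp
    rw [hd]
    ring

end NormalForm

end LocalWedge

namespace LocalWedge

/-! ### Arithmetic of the exponent -/

section Exponents

theorem beta_pos {m n i : ℕ} (hm : 1 ≤ m) (hn : 1 ≤ n) (hi : 1 ≤ i) (hi' : i ≤ m + n - 1) :
    0 < beta m n i := by
  rw [beta]
  split_ifs with h
  · have : (0 : ℝ) < m := by exact_mod_cast hm
    have : (0 : ℝ) < i := by exact_mod_cast hi
    positivity
  · have h1 : (0 : ℝ) < n := by exact_mod_cast hn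
    have h2 : (i : ℝ) < (m : ℝ) + n := by exact_mod_cast (by omega : i < m + n)
    exact div_pos h1 (by linarith)

/-- For `i ≤ m` this amounts to `(i - 1) * (m - i) ≥ 0`; for `i > m` it is the same inequality with
`n` and `m + n - i` in place of `m` and `i`. It lets the measure of a level set absorb the growth of
the integrand. -/
theorem beta_le {m n i : ℕ} (hi : 1 ≤ i) (hi' : i ≤ m + n - 1) :
    beta m n i ≤ (((m - i) + (i - m) + 1 : ℕ) : ℝ) := by
  have h1 : (1 : ℝ) ≤ i := by exact_mod_cast hi
  rw [beta]
  split_ifs with h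
  · have h2 : (i : ℝ) ≤ m := by exact_mod_cast h
    rw [Nat.sub_eq_zero_of_le h, add_zero, Nat.cast_add, Nat.cast_sub h, Nat.cast_one,
      div_le_iff₀ (by linarith)]
    nlinarith
  · push Not at h
    have h2 : (i : ℝ) + 1 ≤ (m : ℝ) + n := by exact_mod_cast (by omega : i + 1 ≤ m + n)
    have h3 : (m : ℝ) ≤ i := by exact_mod_cast h.le
    rw [Nat.sub_eq_zero_of_le h.le, zero_add, Nat.cast_add, Nat.cast_sub h.le, Nat.cast_one,
      div_le_iff₀ (by linarith)]
    nlinarith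

theorem beta_mul {m n i : ℕ} (hi : 1 ≤ i) (hi' : i ≤ m + n - 1) :
    beta m n i * ((n : ℝ) * (min m i : ℕ) - m * ((i : ℝ) - (min m i : ℕ))) = m * n := by
  have h1 : (1 : ℝ) ≤ i := by exact_mod_cast hi
  rw [beta]
  split_ifs with h
  · rw [min_eq_right h]
    field_simp
    ring
  · push Not at h
    have h2 : (i : ℝ) + 1 ≤ (m : ℝ) + n := by exact_mod_cast (by omega : i + 1 ≤ m + n)
    have h3 : (m : ℝ) + n - i ≠ 0 := by linarith
    rw [min_eq_left h.le]
    field_simp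
    ring

end Exponents

section TopDvd

theorem TopDvd.map {R S α γ κ₁ κ₂ : Type*} [CommRing R] [CommRing S] [Fintype α] [Fintype γ]
    [Fintype κ₁] [Fintype κ₂] [DecidableEq κ₁] [DecidableEq κ₂] {p : R}
    {B₁ : Matrix α (κ₁ ⊕ κ₂) R} {B₂ : Matrix γ (κ₁ ⊕ κ₂) R} {s : Matrix α γ R}
    (h : TopDvd p B₁ B₂ s) (φ : R →+* S) :
    TopDvd (φ p) (B₁.map φ) (B₂.map φ) (s.map φ) := by
  intro g hg
  have h1 : shear (B₁.map φ) (B₂.map φ) (s.map φ) = (shear B₁ B₂ s).map φ := by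
    rw [shear, shear, ← Matrix.map_mul]
    ext r k
    rcases r with r | r <;> simp only [Matrix.fromRows_apply_inl, Matrix.fromRows_apply_inr,
      Matrix.map_apply, Matrix.add_apply, map_add]
  rw [h1]
  have h2 := map_dvd φ (h g hg)
  rwa [RingHom.map_det] at h2

end TopDvd

/-! ### Level sets and the integral estimate -/

section Local

open MeasureTheory

variable {L : Type*} [Field L] [Valued L ℤᵐ⁰] {ϖ : L} (hϖ : Valued.v ϖ = WithZero.exp (-1 : ℤ))
  {m n : ℕ}

include hϖ in
theorem absVal_prod_flowWeight {κ : Type*} [Fintype κ] (t : ℤ) (g : κ → Fin m ⊕ Fin n) {a b : ℕ}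
    (ha : (Finset.univ.filter fun k => (g k).isLeft = true).card = a)
    (hab : Fintype.card κ = a + b) :
    absVal (∏ k, flowWeight m n ϖ t (g k)) = (residueCard L : ℝ≥0) ^ (t * (n * a - m * b)) := by
  have hϖ0 : ϖ ≠ 0 := fun h => uniformizer_ne_zero hϖ (Subtype.ext h)
  have h1 : ∀ k, flowWeight m n ϖ t (g k) =
      if (g k).isLeft = true then ϖ ^ (-(n * t)) else ϖ ^ (m * t) := fun k => by
    rcases g k with a | a <;> simp [flowWeight]
  have hb : (Finset.univ.filter fun k => ¬ (g k).isLeft = true).card = b := by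
    have := Finset.card_filter_add_card_filter_not (s := (Finset.univ : Finset κ))
      (fun k => (g k).isLeft = true)
    rw [Finset.card_univ] at this
    omega
  rw [Finset.prod_congr rfl fun k _ => h1 k, Finset.prod_ite, Finset.prod_const, Finset.prod_const,
    ha, hb, ← zpow_natCast, ← zpow_natCast, ← zpow_mul, ← zpow_mul, ← zpow_add₀ hϖ0]
  apply absVal_of_v_eq
  rw [v_zpow hϖ]
  congr 1
  ring

variable {κ₁ κ₂ : Type} [Fintype κ₁] [Fintype κ₂] [DecidableEq κ₁] [DecidableEq κ₂]

open Classical in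
/-- The integral matrices `s` for which all top minors of `u_s B` are divisible by `ϖ ^ l`. -/
def levelSet (B₁ : Matrix (Fin m) (κ₁ ⊕ κ₂) (Valued.integer L))
    (B₂ : Matrix (Fin n) (κ₁ ⊕ κ₂) (Valued.integer L)) (l : ℕ)
    [Fintype (Matrix (Fin m) (Fin n) (Quot hϖ l))] : Set (Matrix (Fin m) (Fin n) L) :=
  ⋃ T ∈ Finset.univ.filter fun T : Matrix (Fin m) (Fin n) (Quot hϖ l) =>
    TopDvd (red hϖ l (uniformizer ϖ hϖ) ^ l) (B₁.map (red hϖ l)) (B₂.map (red hϖ l)) T,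
    redFiber hϖ l T

theorem mem_levelSet {B₁ : Matrix (Fin m) (κ₁ ⊕ κ₂) (Valued.integer L)}
    {B₂ : Matrix (Fin n) (κ₁ ⊕ κ₂) (Valued.integer L)} {l : ℕ}
    [Fintype (Matrix (Fin m) (Fin n) (Quot hϖ l))]
    {x : Matrix (Fin m) (Fin n) (Valued.integer L)}
    (h : TopDvd (uniformizer ϖ hϖ ^ l) B₁ B₂ x) :
    x.map (Valued.integer L).subtype ∈ levelSet hϖ B₁ B₂ l := by
  classical
  have h1 := h.map (red hϖ l)
  rw [map_pow] at h1
  rw [levelSet]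
  exact Set.mem_biUnion (x := x.map (red hϖ l)) (by simpa using h1) ⟨x, rfl, rfl⟩

/-- The norm of `g_t u_s v` is controlled by the deepest level set containing `s`. -/
theorem exists_level {i : ℕ} (hq : 2 ≤ residueCard L) {f₁ : κ₁ → Fin m} {f₂ : κ₂ → Fin n}
    {B₁ : Matrix (Fin m) (κ₁ ⊕ κ₂) (Valued.integer L)}
    {B₂ : Matrix (Fin n) (κ₁ ⊕ κ₂) (Valued.integer L)}
    (hB : IsNormalForm (uniformizer ϖ hϖ) f₁ f₂ B₁ B₂) (hcard : Fintype.card (κ₁ ⊕ κ₂) = i)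
    (hi : i ≤ m + n) (t : ℕ) [∀ l, Fintype (Matrix (Fin m) (Fin n) (Quot hϖ l))]
    (x : Matrix (Fin m) (Fin n) (Valued.integer L)) :
    ∃ l ≤ t * (m + n) ^ 2, x.map (Valued.integer L).subtype ∈ levelSet hϖ B₁ B₂ l ∧
      ∃ g : κ₁ ⊕ κ₂ → Fin m ⊕ Fin n, (residueCard L : ℝ≥0) ^
        ((t : ℤ) * (n * (min m i : ℕ) - m * (i - (min m i : ℕ))) - l) ≤
        absVal (∏ k, flowWeight m n ϖ t (g k)) *
          absVal ((((shear B₁ B₂ x).submatrix g id).det : Valued.integer L) : L) := by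
  classical
  have hq1 : (1 : ℝ≥0) ≤ residueCard L := by exact_mod_cast (by omega : 1 ≤ residueCard L)
  have hq0 : (residueCard L : ℝ≥0) ≠ 0 := by positivity
  -- If no level up to the cutoff fails, the unit pivot minor is used. Its weight exponent is at
  -- least `-t * m * (m + n)`, and the cutoff is large enough because `n * m - (m + n) ^ 2 ≤ -m * (m
  -- + n)`.
  by_cases hall : ∀ l ≤ t * (m + n) ^ 2, TopDvd (uniformizer ϖ hϖ ^ l) B₁ B₂ x
  · refine ⟨_, le_rfl, mem_levelSet hϖ (hall _ le_rfl), Sum.map f₁ f₂, ?_⟩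
    have hu := hB.isUnit_det_shear (isUnit_one_add_uniformizer_mul hϖ) x
    rw [isUnit_integer_iff] at hu
    have ha : (Finset.univ.filter fun k : κ₁ ⊕ κ₂ => (Sum.map f₁ f₂ k).isLeft = true).card =
        Fintype.card κ₁ := by
      rw [Finset.card_filter, Fintype.sum_sum_type]
      simp
    rw [absVal_of_v_eq_one hu, mul_one, absVal_prod_flowWeight hϖ t _ ha Fintype.card_sum]
    refine zpow_le_zpow_right₀ hq1 ?_
    have h2 : Fintype.card κ₂ ≤ i := by rw [← hcard, Fintype.card_sum]; omega
    have h3 : (Fintype.card κ₂ : ℤ) ≤ m + n := by exact_mod_cast h2.trans hi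
    have h4 : ((min m i : ℕ) : ℤ) ≤ m := by exact_mod_cast min_le_left m i
    have h5 : ((min m i : ℕ) : ℤ) ≤ i := by exact_mod_cast min_le_right m i
    push_cast
    rw [← mul_sub]
    refine mul_le_mul_of_nonneg_left ?_ (by positivity)
    have h6 : (n : ℤ) * (min m i : ℕ) ≤ n * m := mul_le_mul_of_nonneg_left h4 (by positivity)
    have h7 : (0 : ℤ) ≤ m * (i - (min m i : ℕ)) := mul_nonneg (by positivity) (by linarith)
    have h8 : (m : ℤ) * Fintype.card κ₂ ≤ m * (m + n) :=
      mul_le_mul_of_nonneg_left h3 (by positivity)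
    have h9 : (0 : ℤ) ≤ n * Fintype.card κ₁ := by positivity
    push_cast at h6 h7
    nlinarith [sq_nonneg (n : ℤ)]
  · push Not at hall
    obtain ⟨hl, hn⟩ := Nat.find_spec hall
    -- At the first failing `l`, the point lies in level `l - 1`, and some top minor has absolute
    -- value at least `q ^ (-(l - 1))`.
    set l := Nat.find hall with hldef
    have hl0 : l ≠ 0 := by
      intro h0
      rw [h0] at hn
      exact hn fun g _ => by rw [pow_zero]; exact one_dvd _
    have hmem : TopDvd (uniformizer ϖ hϖ ^ (l - 1)) B₁ B₂ x := by
      have := Nat.find_min hall (m := l - 1) (by omega)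
      by_contra hcon
      exact this ⟨by omega, hcon⟩
    refine ⟨l - 1, by omega, mem_levelSet hϖ hmem, ?_⟩
    simp only [TopDvd, not_forall] at hn
    obtain ⟨g, hg, hnd⟩ := hn
    refine ⟨g, ?_⟩
    rw [uniformizer_pow_dvd_iff, not_le] at hnd
    have h1 := le_absVal_of_lt hq hnd
    rw [IsTop, Fintype.card_fin, hcard] at hg
    have hmi := min_le_right m i
    rw [absVal_prod_flowWeight hϖ t g (b := i - min m i) hg (by rw [hcard]; omega), Nat.cast_sub hmi,
      sub_eq_add_neg ((t : ℤ) * _), zpow_add₀ hq0]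
    gcongr
    refine le_trans (le_of_eq ?_) h1
    congr 1
    rw [Nat.cast_sub (by omega)]
    push_cast
    ring

variable [MeasurableSpace (Matrix (Fin m) (Fin n) L)] [BorelSpace (Matrix (Fin m) (Fin n) L)]
  (μ : Measure (Matrix (Fin m) (Fin n) L)) [μ.IsAddHaarMeasure]
  (h1 : μ (integralMatrices L m n) = 1)

theorem measurableSet_levelSet (B₁ : Matrix (Fin m) (κ₁ ⊕ κ₂) (Valued.integer L))
    (B₂ : Matrix (Fin n) (κ₁ ⊕ κ₂) (Valued.integer L)) (l : ℕ)
    [Fintype (Matrix (Fin m) (Fin n) (Quot hϖ l))] : MeasurableSet (levelSet hϖ B₁ B₂ l) :=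
  Finset.measurableSet_biUnion _ fun T _ => measurableSet_redFiber hϖ l T

-- The count over the quotient modulo `ϖ ^ l`, a chain ring of length exactly `l`, becomes a measure
-- after multiplication by the measure of one residue class.
include h1 in
theorem measure_levelSet_le [Finite (Valued.ResidueField L)] {f₁ : κ₁ → Fin m} {f₂ : κ₂ → Fin n}
    {B₁ : Matrix (Fin m) (κ₁ ⊕ κ₂) (Valued.integer L)}
    {B₂ : Matrix (Fin n) (κ₁ ⊕ κ₂) (Valued.integer L)}
    (hB : IsNormalForm (uniformizer ϖ hϖ) f₁ f₂ B₁ B₂) (l : ℕ) [Finite (Quot hϖ l)]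
    [Fintype (Matrix (Fin m) (Fin n) (Quot hϖ l))] :
    μ (levelSet hϖ B₁ B₂ l) * (residueCard L : ℝ≥0∞) ^ (l * ((m - Fintype.card (κ₁ ⊕ κ₂)) +
      (Fintype.card (κ₁ ⊕ κ₂) - m) + 1)) ≤ 2 ^ m := by
  classical
  let _ := Fintype.ofFinite (Quot hϖ l)
  have hu : ∀ y, IsUnit (1 + red hϖ l (uniformizer ϖ hϖ) * y) := fun y => by
    obtain ⟨y, rfl⟩ := Ideal.Quotient.mk_surjective y
    rw [← map_mul, ← map_one (red hϖ l), ← map_add]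
    exact (isUnit_one_add_uniformizer_mul hϖ y).map _
  have hc := (hB.map (red hϖ l)).card_topDvd_le (isChainRing_quot hϖ l) hu le_rfl
  rw [Fintype.card_fin, Fintype.card_fin] at hc
  have hc' : (Finset.univ.filter fun T : Matrix (Fin m) (Fin n) (Quot hϖ l) =>
      TopDvd (red hϖ l (uniformizer ϖ hϖ) ^ l) (B₁.map (red hϖ l)) (B₂.map (red hϖ l)) T).card *
      residueCard L ^ (l * ((m - Fintype.card (κ₁ ⊕ κ₂)) +
      (Fintype.card (κ₁ ⊕ κ₂) - m) + 1)) ≤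
      2 ^ m * Fintype.card (Matrix (Fin m) (Fin n) (Quot hϖ l)) := by
    have h0 : Fintype.card (Matrix (Fin m) (Fin n) (Quot hϖ l)) =
        Fintype.card (Quot hϖ l) ^ (m * n) := by
      rw [← Nat.card_eq_fintype_card]
      change Nat.card (Fin m → Fin n → Quot hϖ l) = _
      rw [Nat.card_fun, Nat.card_fun, ← pow_mul, Nat.card_fin, Nat.card_fin,
        Nat.card_eq_fintype_card, mul_comm]
    rw [h0]
    have hc2 := hc
    norm_cast at hc2
    convert hc2
  have h2 := card_mul_measure hϖ μ h1 (k := l)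
  rw [levelSet, measure_biUnion_redFiber, mul_right_comm]
  calc _ ≤ ((2 : ℝ≥0∞) ^ m * Fintype.card (Matrix (Fin m) (Fin n) (Quot hϖ l))) * _ := by
        gcongr ?_ * _
        exact_mod_cast hc'
    _ = 2 ^ m := by rw [mul_assoc, h2, mul_one]

include hϖ h1 in
theorem lintegral_wedgeNorm_rpow_le (hm : 1 ≤ m) (hn : 1 ≤ n) {i : ℕ} (hi : 1 ≤ i)
    (hi' : i ≤ m + n - 1) {t : ℕ} (ht : 1 ≤ t) (w : Fin i → Fin (m + n) → L) :
    ∫⁻ s in integralMatrices L m n,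
        (wedgeNorm (wedgeAction (diagFlow m n ϖ t * unipotent s)
          (exteriorPower.ιMulti L i w)) : ℝ≥0∞) ^ (-beta m n i) ∂μ ≤
      ((2 ^ m * ((m + n) ^ 2 + 1) : ℝ≥0) : ℝ≥0∞) * t *
        (residueCard L : ℝ≥0∞) ^ (-((m * n * t : ℕ) : ℤ)) *
        (wedgeNorm (exteriorPower.ιMulti L i w) : ℝ≥0∞) ^ (-beta m n i) := by
  classical
  have hfin : ∀ l, Finite (Quot hϖ l) := finite_quot hϖ μ h1 hm hn
  have hres : Finite (Valued.ResidueField L) := by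
    have := hfin 1
    have e : Quot hϖ 1 ≃+* Valued.ResidueField L := Ideal.quotEquivOfEq (by
      rw [pow_one, maximalIdeal_eq_span hϖ])
    exact Finite.of_equiv _ e.toEquiv
  have hq : 2 ≤ residueCard L := Finite.one_lt_card (α := Valued.ResidueField L)
  have hβ := beta_pos hm hn hi hi'
  set β := beta m n i with hβdef
  set q : ℝ≥0 := (residueCard L : ℝ≥0) with hqdef
  have hq1 : (1 : ℝ≥0) ≤ q := by rw [hqdef]; exact_mod_cast (by omega : 1 ≤ residueCard L)
  have hq0 : q ≠ 0 := (zero_lt_one.trans_le hq1).ne'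
  have hqE : (residueCard L : ℝ≥0∞) = (q : ℝ≥0∞) := by simp [hqdef]
  have hqE0 : (q : ℝ≥0∞) ≠ 0 := by exact_mod_cast hq0
  set V := wedgeNorm (exteriorPower.ιMulti L i w) with hV
  rw [hqE]
  -- For `v = 0` the right side is infinite, as its other factors are nonzero.
  by_cases hV0 : V = 0
  · rw [hV0, ENNReal.coe_zero, ENNReal.zero_rpow_of_neg (by linarith), ENNReal.mul_top]
    · exact le_top
    · refine mul_ne_zero (mul_ne_zero ?_ (by exact_mod_cast (by omega : t ≠ 0))) ?_
      · rw [ENNReal.coe_ne_zero]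
        positivity
      · exact (ENNReal.zpow_pos hqE0 ENNReal.coe_ne_top _).ne'
  let _ : ∀ l, Fintype (Matrix (Fin m) (Fin n) (Quot hϖ l)) := fun l => by
    have : Fintype (Quot hϖ l) := Fintype.ofFinite _
    exact (inferInstance : Fintype (Fin m → Fin n → Quot hϖ l))
  obtain ⟨κ₁, κ₂, _, _, _, _, f₁, f₂, B₁, B₂, hB, hcard, hlow⟩ := exists_isNormalForm hϖ hq w hV0
  set N := t * (m + n) ^ 2 with hN
  set C : ℝ≥0∞ := (q : ℝ≥0∞) ^ (-((m * n * t : ℕ) : ℤ)) * (V : ℝ≥0∞) ^ (-β) with hC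
  -- The single level supplied by `exists_level` already bounds the integrand; summing over all
  -- levels makes the bound measurable in `s` without selecting a level.
  have hpt : ∀ s ∈ integralMatrices L m n,
      (wedgeNorm (wedgeAction (diagFlow m n ϖ t * unipotent s)
          (exteriorPower.ιMulti L i w)) : ℝ≥0∞) ^ (-β) ≤
        C * ∑ l ∈ Finset.range (N + 1),
          (levelSet hϖ B₁ B₂ l).indicator (fun _ => (q : ℝ≥0∞) ^ ((l : ℝ) * β)) s := by
    intro s hs
    obtain ⟨x, rfl⟩ : ∃ x : Matrix (Fin m) (Fin n) (Valued.integer L),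
        x.map (Valued.integer L).subtype = s := ⟨Matrix.of fun a b => ⟨s a b, hs a b⟩, rfl⟩
    obtain ⟨l, hl, hmem, g, hg⟩ := exists_level hϖ hq hB hcard (by omega) t x
    have h2 := (mul_le_mul_of_nonneg_left hg (zero_le (a := V))).trans (hlow t x g)
    set e : ℤ := (t : ℤ) * (n * (min m i : ℕ) - m * (i - (min m i : ℕ))) with he
    have h3 : ((V * q ^ (e - l) : ℝ≥0) : ℝ≥0∞) ^ (-β) =
        C * (q : ℝ≥0∞) ^ ((l : ℝ) * β) := by
      rw [hC, ENNReal.coe_mul, ENNReal.mul_rpow_of_ne_zero (by exact_mod_cast hV0)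
        (by exact_mod_cast zpow_ne_zero _ hq0), ENNReal.coe_zpow hq0, ← ENNReal.rpow_intCast,
        ← ENNReal.rpow_mul, ← ENNReal.rpow_intCast, mul_comm (_ ^ (_ : ℝ)) ((V : ℝ≥0∞) ^ (-β)),
        mul_assoc, ← ENNReal.rpow_add _ _ hqE0 ENNReal.coe_ne_top]
      congr 2
      have hb := beta_mul (m := m) (n := n) hi hi'
      rw [← hβdef] at hb
      rw [he]
      push_cast at hb ⊢
      -- Here `beta_mul` turns the top weight into exactly `q ^ (-mnt)`.
      linear_combination (-(t : ℝ)) * hb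
    calc _ ≤ ((V * q ^ (e - l) : ℝ≥0) : ℝ≥0∞) ^ (-β) := by
          rw [ENNReal.rpow_neg, ENNReal.rpow_neg, ENNReal.inv_le_inv]
          exact ENNReal.rpow_le_rpow (ENNReal.coe_le_coe.2 h2) hβ.le
      _ = C * (q : ℝ≥0∞) ^ ((l : ℝ) * β) := h3
      _ ≤ _ := by
          gcongr
          refine le_trans (le_of_eq ?_) (Finset.single_le_sum (f := fun l =>
            (levelSet hϖ B₁ B₂ l).indicator (fun _ => (q : ℝ≥0∞) ^ ((l : ℝ) * β))
              (x.map (Valued.integer L).subtype)) (fun _ _ => zero_le)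
              (Finset.mem_range.2 (Nat.lt_succ_iff.2 hl)))
          rw [Set.indicator_of_mem hmem]
  have hmeas : MeasurableSet (integralMatrices L m n) := by
    have := (isOpen_setOf_v_le hϖ (m := m) (n := n) 0).measurableSet
    simpa [integralMatrices, Valuation.mem_integer_iff] using this
  have hlevel : ∀ l : ℕ, (q : ℝ≥0∞) ^ ((l : ℝ) * β) * μ (levelSet hϖ B₁ B₂ l) ≤ 2 ^ m := by
    intro l
    have := hfin l
    refine le_trans ?_ (measure_levelSet_le hϖ μ h1 hB l)
    rw [mul_comm, hqE, hcard, ← ENNReal.rpow_natCast, Nat.cast_mul]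
    gcongr
    · exact_mod_cast hq1
    · exact beta_le hi hi'
  calc _ ≤ ∫⁻ s in integralMatrices L m n, C * ∑ l ∈ Finset.range (N + 1),
          (levelSet hϖ B₁ B₂ l).indicator (fun _ => (q : ℝ≥0∞) ^ ((l : ℝ) * β)) s ∂μ :=
        setLIntegral_mono' hmeas hpt
    _ ≤ ∫⁻ s, C * ∑ l ∈ Finset.range (N + 1),
          (levelSet hϖ B₁ B₂ l).indicator (fun _ => (q : ℝ≥0∞) ^ ((l : ℝ) * β)) s ∂μ :=
        setLIntegral_le_lintegral _ _
    _ = C * ∑ l ∈ Finset.range (N + 1),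
          (q : ℝ≥0∞) ^ ((l : ℝ) * β) * μ (levelSet hϖ B₁ B₂ l) := by
        have hms : ∀ l ∈ Finset.range (N + 1), Measurable
            ((levelSet hϖ B₁ B₂ l).indicator (fun _ => (q : ℝ≥0∞) ^ ((l : ℝ) * β))) := fun l _ =>
          measurable_const.indicator (measurableSet_levelSet hϖ B₁ B₂ l)
        rw [lintegral_const_mul _ (Finset.measurable_sum _ hms), lintegral_finsetSum _ hms]
        congr 1
        exact Finset.sum_congr rfl fun l _ =>
          lintegral_indicator_const (measurableSet_levelSet hϖ B₁ B₂ l) _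
    _ ≤ C * ∑ l ∈ Finset.range (N + 1), 2 ^ m := by
        gcongr with l
        exact hlevel l
    _ = C * ((N + 1 : ℕ) * 2 ^ m) := by
        rw [Finset.sum_const, Finset.card_range, nsmul_eq_mul]
    _ ≤ C * (((2 ^ m * ((m + n) ^ 2 + 1) : ℝ≥0) : ℝ≥0∞) * t) := by
        gcongr C * ?_
        -- The `N + 1` levels number at most `((m + n) ^ 2 + 1) * t` because `t ≥ 1`.
        have : (N + 1) * 2 ^ m ≤ 2 ^ m * ((m + n) ^ 2 + 1) * t := by
          rw [hN, mul_comm, mul_assoc]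
          gcongr
          nlinarith
        exact_mod_cast this
    _ = _ := by rw [hC]; ring

end Local

end LocalWedge

theorem proposition3p1 (m n : ℕ) (hm : 1 ≤ m) (hn : 1 ≤ n) :
    ∃ c : ℝ≥0, 0 < c ∧
      ∀ (Fq : Type*) [Field Fq] [Finite Fq]
        (K : Type*) [Field K] [Algebra Fq⟮X⟯ K] [FunctionField Fq K]
        (ν : Valuation K ℤᵐ⁰) (_ : Function.Surjective ν)
        (ϖ : K) (_ : ν ϖ = WithZero.exp (-1))
        [MeasurableSpace (Matrix (Fin m) (Fin n) ν.Completion)]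
        [BorelSpace (Matrix (Fin m) (Fin n) ν.Completion)]
        (μ : MeasureTheory.Measure (Matrix (Fin m) (Fin n) ν.Completion))
        [μ.IsAddHaarMeasure]
        (_ : μ (LocalWedge.integralMatrices ν.Completion m n) = 1)
        (i : ℕ) (_ : 1 ≤ i) (_ : i ≤ m + n - 1)
        (t : ℕ) (_ : 1 ≤ t)
        (v : ⋀[ν.Completion]^i (Fin (m + n) → ν.Completion))
        (_ : LocalWedge.IsDecomposable v),
        ∫⁻ s in LocalWedge.integralMatrices ν.Completion m n,
            (LocalWedge.wedgeNorm (LocalWedge.wedgeAction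
              (LocalWedge.diagFlow m n (ϖ : ν.Completion) t * LocalWedge.unipotent s) v) : ℝ≥0∞)
              ^ (-LocalWedge.beta m n i) ∂μ
          ≤ (c : ℝ≥0∞) * t
              * (LocalWedge.residueCard ν.Completion : ℝ≥0∞) ^ (-((m * n * t : ℕ) : ℤ))
              * (LocalWedge.wedgeNorm v : ℝ≥0∞) ^ (-LocalWedge.beta m n i) := by
  refine ⟨2 ^ m * ((m + n) ^ 2 + 1), by positivity, ?_⟩
  intro Fq _ _ K _ _ _ ν _ ϖ hϖ _ _ μ _ hμ i hi hi' t ht v hv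
  obtain ⟨w, rfl⟩ := hv
  have hϖ' : Valued.v (ϖ : ν.Completion) = WithZero.exp (-1 : ℤ) := by
    rw [← hϖ]
    exact Valued.valuedCompletion_apply _
  exact LocalWedge.lintegral_wedgeNorm_rpow_le hϖ' μ hμ hm hn hi hi' ht w
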